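/- Let $\mathcal X=\{1,2,\dots\}$, let $\mathcal Y$ be a finite set (with the discrete $\sigma$-algebra), $L\ge 1$ an integer, $\varepsilon$ a real number and $Q$ a probability distribution on $\mathcal X$ with decreasing rearrangement $Q^{\downarrow}(1)\ge Q^{\downarrow}(2)\ge\cdots$. Assume $$1-\sum_{x=1}^{|\mathcal Y|L}Q^{\downarrow}(x)\ \le\ \varepsilon\ \le\ 1-\sum_{x=1}^{L}Q^{\downarrow}(x).$$ For $j\ge 1$ put $\mathcal V(j)=\dfrac{(1-\varepsilon)-\sum_{x=1}^{j-1}Q^{\downarrow}(x)}{L-j+1}$ if $j\le L$ and $\mathcal V(j)=1$ if $j>L$. For integers $k\ge L$ put $\mathcal W(L)=-1$ and $\mathcal W(k)=\dfrac{\sum_{x=1}^{k}Q^{\downarrow}(x)-(1-\varepsilon)}{k-L}$ if $k>L$. Let $$J=\min\{j\ge 1: Q^{\downarrow}(j)<\mathcal V(j)\},\qquad K_2=\max\{L\le k\le|\mathcal Y|L:\ \mathcal W(k)<Q^{\downarrow}(k)\}.$$ The Fano-distribution of type 2, $P_2=P^{(Q,L,\varepsilon,\mathcal Y)}_{\text{Fano-type2}}$,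 is given by $P_2(x)=Q^{\downarrow}(x)$ if $x<J$ or $x>K_2$, $P_2(x)=\mathcal V(J)$ if $J\le x\le L$, and $P_2(x)=\mathcal W(K_2)$ if $L<x\le K_2$. For a distribution $P$ on $\mathcal X$ and $\alpha\in(0,1)\cup(1,\infty)$ let $\|P\|_\alpha=(\sum_x P(x)^\alpha)^{1/\alpha}$, $H_\alpha(P)=\frac1{1-\alpha}\log\sum_xP(x)^\alpha$, and let $H_1(P)=\sum_x\eta(P(x))$ with $\eta(u)=-u\log u$, $\eta(0)=0$ (values in $[0,\infty]$). For random variables $X,Y$ with values in $\mathcal X,\mathcal Y$, with $P_{X|Y}$ the regular conditional distribution of $X$ given $Y$, let $$H^{\mathrm A}_\alpha(X|Y)=\tfrac{\alpha}{1-\alpha}\log\mathbb E\big[\|P_{X|Y}\|_\alpha\big],\qquad H^{\mathrm H}_\alpha(X|Y)=\tfrac{1}{1-\alpha}\log\mathbb E\big[\|P_{X|Y}\|_\alpha^\alpha\big]$$ be Arimoto's and Hayashi's conditional Rényi entropies, and let $H_1^{\mathrm A}(X|Y)=H_1^{\mathrm H}(X|Y)=H(X|Y)=\mathbb E[H_1(P_{X|Y})]$.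 Let $P_{\mathrm e}^{(L)}(X|Y)=\min_f\mathbb P\{X\notin f(Y)\}$, where $f$ ranges over the maps from $\mathcal Y$ to the subsets of $\mathcal X$ with at least $1$ and at most $L$ elements. Then $P_2$ is a probability distribution on $\mathcal X$, and for every $\dagger\in\{\mathrm A,\mathrm H\}$ and every $\alpha\in(0,\infty)$, $$\sup_{(X,Y):\,P_{\mathrm e}^{(L)}(X|Y)\le\varepsilon,\ P_X=Q}H^{\dagger}_\alpha(X|Y)\ \le\ H_\alpha(P_2),$$ where for $\alpha\ne1$ $$H_\alpha(P_2)=\frac1{1-\alpha}\log\Big((L-J+1)\,\mathcal V(J)^\alpha+(K_2-L)\,\mathcal W(K_2)^\alpha+\sum_{x<J\text{ or }x>K_2}Q^{\downarrow}(x)^\alpha\Big)$$ and for $\alpha=1$ $$H_1(P_2)=(L-J+1)\,\eta(\mathcal V(J))+(K_2-L)\,\eta(\mathcal W(K_2))+\sum_{x<J\text{ or }x>K_2}\eta(Q^{\downarrow}(x)),$$ a term with coefficient $0$ being read as $0$. In particular, for $\alpha=1$ and $L=1$ this gives the refined Ho–Verdú–Fano inequality $$\sup_{(X,Y):\,P_{\mathrm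 e}^{(1)}(X|Y)\le\varepsilon,\ P_X=Q}H(X|Y)\ \le\ \eta(1-\varepsilon)+(K_2-1)\,\eta(\mathcal W(K_2))+\sum_{x>K_2}\eta(Q^{\downarrow}(x)).$$ -/

import Mathlib

open MeasureTheory ProbabilityTheory
open scoped ENNReal

universe u v

noncomputable section

namespace FanoRenyi

/-- The alphabet `{1, 2, …}` carries the discrete σ-algebra. -/
instance instMeasurableSpacePNat : MeasurableSpace ℕ+ := ⊤

instance instDiscreteMeasurableSpacePNat : DiscreteMeasurableSpace ℕ+ := ⟨fun _ => trivial⟩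

/-! ### Decreasing rearrangement and the Fano-distribution of type 2 -/

/-- The decreasing rearrangement of `Q`: for `i ≥ 1` this is the `i`-th largest of the masses of `Q`
(with multiplicity), i.e. the least `t ≥ 0` such that fewer than `i` symbols have mass `> t`. -/
def decr (Q : PMF ℕ+) (i : ℕ) : ℝ :=
  sInf {t : ℝ | 0 ≤ t ∧ {x : ℕ+ | t < (Q x).toReal}.encard < (i : ℕ∞)}

/-- The partial sum of the `k` largest masses of `Q`. -/
def topSum (Q : PMF ℕ+) (k : ℕ) : ℝ := ∑ i ∈ Finset.Icc 1 k, decr Q i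

/-- The standing assumption on the system `(Q, L, ε, 𝒴)`, where `m` is the cardinality of `𝒴`. -/
def Admissible (Q : PMF ℕ+) (L : ℕ) (ε : ℝ) (m : ℕ) : Prop :=
  1 - topSum Q (m * L) ≤ ε ∧ ε ≤ 1 - topSum Q L

/-- The weight `𝒱(j)`, `j ≥ 1`. -/
def V (Q : PMF ℕ+) (L : ℕ) (ε : ℝ) (j : ℕ) : ℝ :=
  if j ≤ L then ((1 - ε) - topSum Q (j - 1)) / ((L : ℝ) - (j : ℝ) + 1) else 1

/-- The weight `𝒲(k)`, `L ≤ k < ∞`. -/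
def W (Q : PMF ℕ+) (L : ℕ) (ε : ℝ) (k : ℕ) : ℝ :=
  if k = L then -1 else (topSum Q k - (1 - ε)) / ((k : ℝ) - (L : ℝ))

/-- `J = min {j ≥ 1 | Q↓(j) < 𝒱(j)}`. -/
def J (Q : PMF ℕ+) (L : ℕ) (ε : ℝ) : ℕ :=
  sInf {j : ℕ | 1 ≤ j ∧ decr Q j < V Q L ε j}

/-- `K₂ = max {L ≤ k ≤ m L | 𝒲(k) < Q↓(k)}`, where `m` is the cardinality of `𝒴`. -/
def K₂ (Q : PMF ℕ+) (L : ℕ) (ε : ℝ) (m : ℕ) : ℕ :=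
  sSup {k : ℕ | L ≤ k ∧ k ≤ m * L ∧ W Q L ε k < decr Q k}

/-- The mass function of the Fano-distribution of type 2. -/
def fanoType2 (Q : PMF ℕ+) (L : ℕ) (ε : ℝ) (m : ℕ) (x : ℕ+) : ℝ :=
  if (x : ℕ) < J Q L ε ∨ K₂ Q L ε m < (x : ℕ) then decr Q x
  else if (x : ℕ) ≤ L then V Q L ε (J Q L ε)
  else W Q L ε (K₂ Q L ε m)

/-! ### Unconditional entropies; an element of `𝒫(𝒳)` is given by its mass function -/

/-- The Shannon entropy `∑ₓ P(x) log (1 / P(x)) ∈ [0, ∞]`. -/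
def shannonEntropy (P : ℕ+ → ℝ) : ℝ≥0∞ := ∑' x, ENNReal.ofReal (Real.negMulLog (P x))

/-- The `ℓ_α`-norm `(∑ₓ P(x)^α)^(1/α) ∈ [0, ∞]`. -/
def lNorm (α : ℝ) (P : ℕ+ → ℝ) : ℝ≥0∞ := (∑' x, ENNReal.ofReal (P x) ^ α) ^ (1 / α)

/-- The Rényi entropy of order `α`, with the Shannon entropy at `α = 1`. -/
def renyiEntropy (α : ℝ) (P : ℕ+ → ℝ) : EReal :=
  if α = 1 then (shannonEntropy P : EReal)
  else ((1 / (1 - α) : ℝ) : EReal) * ENNReal.log (∑' x, ENNReal.ofReal (P x) ^ α)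

/-! ### Conditional entropies and the error probability of list decoding -/

section Conditional

variable {Ω 𝒴 : Type*} [MeasurableSpace Ω] [MeasurableSpace 𝒴]

/-- The mass function of the regular conditional distribution `P_{X|Y}` at `ω`. -/
def condLaw (μ : Measure Ω) [IsProbabilityMeasure μ] (X : Ω → ℕ+) (Y : Ω → 𝒴) (ω : Ω) (x : ℕ+) :
    ℝ :=
  (condDistrib X Y μ (Y ω)).real {x}

/-- The conditional Shannon entropy `E[H(P_{X|Y})]`. -/
def condShannon (μ : Measure Ω) [IsProbabilityMeasure μ] (X : Ω → ℕ+) (Y : Ω → 𝒴) : ℝ≥0∞ :=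
  ∫⁻ ω, shannonEntropy (condLaw μ X Y ω) ∂μ

/-- Arimoto's conditional Rényi entropy, with the conditional Shannon entropy at `α = 1`. -/
def arimoto (α : ℝ) (μ : Measure Ω) [IsProbabilityMeasure μ] (X : Ω → ℕ+) (Y : Ω → 𝒴) : EReal :=
  if α = 1 then (condShannon μ X Y : EReal)
  else ((α / (1 - α) : ℝ) : EReal) * ENNReal.log (∫⁻ ω, lNorm α (condLaw μ X Y ω) ∂μ)

/-- Hayashi's conditional Rényi entropy, with the conditional Shannon entropy at `α = 1`. -/
def hayashi (α : ℝ) (μ : Measure Ω) [IsProbabilityMeasure μ] (X : Ω → ℕ+) (Y : Ω → 𝒴) : EReal :=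
  if α = 1 then (condShannon μ X Y : EReal)
  else ((1 / (1 - α) : ℝ) : EReal) * ENNReal.log (∫⁻ ω, lNorm α (condLaw μ X Y ω) ^ α ∂μ)

/-- The minimum average error probability under list decoding with list size at most `L`. -/
def listError (L : ℕ) (μ : Measure Ω) (X : Ω → ℕ+) (Y : Ω → 𝒴) : ℝ :=
  ⨅ f : {f : 𝒴 → Finset ℕ+ // ∀ y, 1 ≤ (f y).card ∧ (f y).card ≤ L},
    μ.real {ω | X ω ∉ f.1 (Y ω)}

/-- `(X, Y)` is a pair of random variables on `(Ω, μ)` with `P_e^{(L)}(X | Y) ≤ ε` and `P_X = Q`. -/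
structure Feasible (Q : PMF ℕ+) (L : ℕ) (ε : ℝ) (μ : Measure Ω) (X : Ω → ℕ+) (Y : Ω → 𝒴) :
    Prop where
  measurable_X : Measurable X
  measurable_Y : Measurable Y
  law_X : μ.map X = Q.toMeasure
  error_le : listError L μ X Y ≤ ε

end Conditional

/-- The supremum of Arimoto's conditional Rényi entropy over all feasible pairs `(X, Y)`. -/
def supArimoto (α : ℝ) (Q : PMF ℕ+) (L : ℕ) (ε : ℝ) (𝒴 : Type v) [MeasurableSpace 𝒴] : EReal :=
  sSup {h : EReal | ∃ (Ω : Type u) (_ : MeasurableSpace Ω) (μ : Measure Ω)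
    (_ : IsProbabilityMeasure μ) (X : Ω → ℕ+) (Y : Ω → 𝒴),
    Feasible Q L ε μ X Y ∧ h = arimoto α μ X Y}

/-- The supremum of Hayashi's conditional Rényi entropy over all feasible pairs `(X, Y)`. -/
def supHayashi (α : ℝ) (Q : PMF ℕ+) (L : ℕ) (ε : ℝ) (𝒴 : Type v) [MeasurableSpace 𝒴] : EReal :=
  sSup {h : EReal | ∃ (Ω : Type u) (_ : MeasurableSpace Ω) (μ : Measure Ω)
    (_ : IsProbabilityMeasure μ) (X : Ω → ℕ+) (Y : Ω → 𝒴),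
    Feasible Q L ε μ X Y ∧ h = hayashi α μ X Y}

/-- The supremum of the conditional Shannon entropy over all feasible pairs `(X, Y)`. -/
def supShannon (Q : PMF ℕ+) (L : ℕ) (ε : ℝ) (𝒴 : Type v) [MeasurableSpace 𝒴] : ℝ≥0∞ :=
  sSup {h : ℝ≥0∞ | ∃ (Ω : Type u) (_ : MeasurableSpace Ω) (μ : Measure Ω)
    (_ : IsProbabilityMeasure μ) (X : Ω → ℕ+) (Y : Ω → 𝒴),
    Feasible Q L ε μ X Y ∧ h = condShannon μ X Y}

end FanoRenyi

end

open FanoRenyi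

namespace FanoRenyi

/-! ### Enumeration of a mass function in decreasing order -/

/-! A pair `(X, Y)` writes `Q` as a mixture of its conditional laws. Rearrange each of these
decreasingly and average with the same weights; call the result `R` (`avgDecr`). Entropies ignore
the order of symbols, so Jensen (Shannon, Hayashi) or Minkowski and its reverse (Arimoto) bound the
conditional entropy by the entropy of `R`.

Two facts control the partial sums of `R`. Using one list for all `y` shows that they dominate those
of `Q↓` (`IsMixture.topSum_le`). Using nearly optimal lists, enlarged by `j` symbols outside their
union, shows that the first `L + j` terms weigh at least `1 - ε` plus the masses of `Q↓` at the
ranks `|𝒴|L + 1, …, |𝒴|L + j` (`IsMixture.list_add_topSum_le`).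

These inequalities make `R` majorize the Fano-distribution. Majorization is expressed by the
excesses `∑ (P(x) - s)⁺` for `s > 0`: each superlevel set of the Fano-distribution has a shape for
which one of the two facts applies (`hinge_fanoType2_le`). Finally `t ^ α` and `-t log t` are
integrals over `s` of such excesses, up to linear terms, so comparing excesses compares entropies.
-/

theorem hasSum_one_of_tsum_ofReal {ι : Type*} {f : ι → ℝ} (hf : ∀ i, 0 ≤ f i)
    (h : ∑' i, ENNReal.ofReal (f i) = 1) : HasSum f 1 := by
  have hs : Summable f := by
    have h1 : ∑' i, ENNReal.ofReal (f i) ≠ ⊤ := by rw [h]; simp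
    have := ENNReal.summable_toReal h1
    simpa [ENNReal.toReal_ofReal (hf _)] using this
  have h2 := ENNReal.ofReal_tsum_of_nonneg hf hs
  rw [h, ENNReal.ofReal_eq_one] at h2
  exact h2 ▸ hs.hasSum

theorem hasSum_toReal (Q : PMF ℕ+) : HasSum (fun x => (Q x).toReal) 1 := by
  refine hasSum_one_of_tsum_ofReal (fun _ => ENNReal.toReal_nonneg) ?_
  simp [ENNReal.ofReal_toReal (Q.apply_ne_top _), Q.tsum_coe]

/-- Summable masses tend to zero, so only finitely many reach a given positive value and a maximum
exists among these. -/
theorem exists_argmax_compl (Q : PMF ℕ+) (s : Finset ℕ+) :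
    ∃ x, x ∉ s ∧ ∀ y ∉ s, (Q y).toReal ≤ (Q x).toReal := by
  classical
  obtain ⟨x₀, hx₀⟩ := Infinite.exists_notMem_finset s
  by_cases h : ∀ y ∉ s, (Q y).toReal ≤ 0
  · exact ⟨x₀, hx₀, fun y hy => (h y hy).trans ENNReal.toReal_nonneg⟩
  push Not at h
  obtain ⟨x₁, hx₁, hpos⟩ := h
  have hfin : {y | (Q x₁).toReal ≤ (Q y).toReal}.Finite := by
    have ht := (hasSum_toReal Q).summable.tendsto_cofinite_zero
    have := ht.eventually (gt_mem_nhds hpos)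
    simpa [Filter.eventually_cofinite] using this
  obtain ⟨x, hx, hmax⟩ := Finset.exists_max_image (hfin.toFinset \ s) (fun y => (Q y).toReal)
    ⟨x₁, by simp [hx₁]⟩
  simp only [Finset.mem_sdiff, Set.Finite.mem_toFinset, Set.mem_ofPred_eq] at hx hmax
  refine ⟨x, hx.2, fun y hy => ?_⟩
  by_cases hy' : (Q x₁).toReal ≤ (Q y).toReal
  · exact hmax y ⟨hy', hy⟩
  · exact (le_of_not_ge hy').trans hx.1

theorem exists_decreasing_enum (Q : PMF ℕ+) :
    ∃ e : ℕ → ℕ+, Function.Injective e ∧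
      ∀ n, ∀ x ∉ (Finset.range n).image e, (Q x).toReal ≤ (Q (e n)).toReal := by
  classical
  choose g hg hmax using exists_argmax_compl Q
  let F : ℕ → Finset ℕ+ := fun n => Nat.rec ∅ (fun _ s => insert (g s) s) n
  have hF : ∀ n, F n = (Finset.range n).image (fun k => g (F k)) := by
    intro n
    induction n with
    | zero => rfl
    | succ n ih =>
      rw [Finset.range_add_one, Finset.image_insert, ← ih]
  refine ⟨fun n => g (F n), ?_, fun n x hx => hmax (F n) x ?_⟩
  · refine Function.Injective.of_lt_imp_ne fun a b hab heq => hg (F b) ?_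
    rw [← heq, hF b]
    exact Finset.mem_image.2 ⟨a, Finset.mem_range.2 hab, rfl⟩
  · rwa [hF n]

/-- The greedy enumeration need not be surjective: with infinite support it never reaches symbols of
mass zero. A missed symbol weighs at most every `Q (e n)`, and these tend to zero. -/
theorem exists_enum (Q : PMF ℕ+) :
    ∃ e : ℕ → ℕ+, Function.Injective e ∧ (∀ n, decr Q (n + 1) = (Q (e n)).toReal) ∧
      (∀ x ∉ Set.range e, (Q x).toReal = 0) ∧
      ∀ n, ∀ x ∉ (Finset.range n).image e, (Q x).toReal ≤ (Q (e n)).toReal := by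
  classical
  obtain ⟨e, he, hmax⟩ := exists_decreasing_enum Q
  have hanti : ∀ i n, i ≤ n → (Q (e n)).toReal ≤ (Q (e i)).toReal := by
    intro i n hin
    apply hmax
    simp only [Finset.mem_image, Finset.mem_range, not_exists, not_and]
    intro k hk hek
    have := he hek
    omega
  refine ⟨e, he, fun n => ?_, fun x hx => ?_, hmax⟩
  · have hset : {t : ℝ | 0 ≤ t ∧ {x : ℕ+ | t < (Q x).toReal}.encard < ((n + 1 : ℕ) : ℕ∞)}
        = Set.Ici (Q (e n)).toReal := by
      ext t
      simp only [Set.mem_ofPred_eq, Set.mem_Ici]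
      constructor
      · rintro ⟨_, hlt⟩
        by_contra! hcon
        have hsub : (((Finset.range (n + 1)).image e : Finset ℕ+) : Set ℕ+)
            ⊆ {x : ℕ+ | t < (Q x).toReal} := by
          intro x hx
          obtain ⟨k, hk, rfl⟩ := Finset.mem_image.1 (Finset.mem_coe.1 hx)
          exact hcon.trans_le (hanti k n (Nat.lt_succ_iff.1 (Finset.mem_range.1 hk)))
        have := Set.encard_le_encard hsub
        rw [Set.encard_coe_eq_coe_finsetCard, Finset.card_image_of_injective _ he,
          Finset.card_range] at this
        exact absurd hlt (not_lt.2 this)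
      · intro h
        refine ⟨ENNReal.toReal_nonneg.trans h, ?_⟩
        have hsub : {x : ℕ+ | t < (Q x).toReal}
            ⊆ (((Finset.range n).image e : Finset ℕ+) : Set ℕ+) := by
          intro x hx
          by_contra hcon
          exact absurd ((hmax n x (by simpa using hcon)).trans h) (not_le.2 hx)
        refine (Set.encard_le_encard hsub).trans_lt ?_
        rw [Set.encard_coe_eq_coe_finsetCard, Finset.card_image_of_injective _ he,
          Finset.card_range]
        exact_mod_cast Nat.lt_succ_self n
    rw [decr, hset, csInf_Ici]
  · have ht : Filter.Tendsto (fun n => (Q (e n)).toReal) Filter.atTop (nhds 0) := by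
      have := (hasSum_toReal Q).summable.tendsto_cofinite_zero.comp he.tendsto_cofinite
      rwa [Nat.cofinite_eq_atTop] at this
    refine le_antisymm (ge_of_tendsto' ht fun n => hmax n x ?_) ENNReal.toReal_nonneg
    intro hmem
    obtain ⟨k, _, rfl⟩ := Finset.mem_image.1 hmem
    exact hx ⟨k, rfl⟩

theorem decr_nonneg (Q : PMF ℕ+) (i : ℕ) : 0 ≤ decr Q i :=
  Real.sInf_nonneg fun _ h => h.1

theorem decr_anti (Q : PMF ℕ+) {i j : ℕ} (hi : 1 ≤ i) (hij : i ≤ j) : decr Q j ≤ decr Q i := by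
  obtain ⟨e, he, hd, -, hmax⟩ := exists_enum Q
  obtain ⟨i, rfl⟩ := Nat.exists_eq_add_of_le' hi
  obtain ⟨j, rfl⟩ := Nat.exists_eq_add_of_le' (hi.trans hij)
  rw [hd, hd]
  apply hmax
  simp only [Finset.mem_image, Finset.mem_range, not_exists, not_and]
  intro k hk hek
  have := he hek
  omega

theorem topSum_eq_sum_range (Q : PMF ℕ+) (k : ℕ) :
    topSum Q k = ∑ n ∈ Finset.range k, decr Q (n + 1) := by
  rw [topSum, ← Finset.sum_image (f := decr Q) (g := fun n => n + 1) (by simp)]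
  congr 1
  ext i
  simp only [Finset.mem_Icc, Finset.mem_image, Finset.mem_range]
  constructor
  · rintro ⟨h1, h2⟩
    exact ⟨i - 1, by omega, by omega⟩
  · rintro ⟨a, h1, rfl⟩
    omega

theorem topSum_succ (Q : PMF ℕ+) (k : ℕ) : topSum Q (k + 1) = topSum Q k + decr Q (k + 1) := by
  simp [topSum_eq_sum_range, Finset.sum_range_succ]

theorem topSum_zero (Q : PMF ℕ+) : topSum Q 0 = 0 := by simp [topSum]

theorem topSum_mono (Q : PMF ℕ+) : Monotone (topSum Q) :=
  monotone_nat_of_le_succ fun k => by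
    rw [topSum_succ]
    linarith [decr_nonneg Q (k + 1)]

/-- A sum of a function of the masses may be computed on the decreasing rearrangement. -/
theorem tsum_comp_decr (Q : PMF ℕ+) (G : ℝ → ℝ≥0∞) (hG : G 0 = 0) :
    ∑' x : ℕ+, G (decr Q x) = ∑' x : ℕ+, G (Q x).toReal := by
  obtain ⟨e, he, hd, h0, -⟩ := exists_enum Q
  rw [tsum_pnat_eq_tsum_succ (f := fun n => G (decr Q n)),
    ← he.tsum_eq (f := fun x => G (Q x).toReal)]
  · simp [hd]
  · intro x hx
    by_contra hcon
    exact hx (by simp [h0 x hcon, hG])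

theorem tsum_ofReal_decr (Q : PMF ℕ+) : ∑' x : ℕ+, ENNReal.ofReal (decr Q x) = 1 := by
  rw [tsum_comp_decr Q ENNReal.ofReal (by simp)]
  simp [ENNReal.ofReal_toReal (Q.apply_ne_top _), Q.tsum_coe]

theorem hasSum_decr (Q : PMF ℕ+) : HasSum (fun x : ℕ+ => decr Q x) 1 :=
  hasSum_one_of_tsum_ofReal (fun _ => decr_nonneg Q _) (tsum_ofReal_decr Q)

theorem exists_card_eq_topSum (Q : PMF ℕ+) (k : ℕ) :
    ∃ T : Finset ℕ+, T.card = k ∧ ∑ x ∈ T, (Q x).toReal = topSum Q k := by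
  classical
  obtain ⟨e, he, hd, -, -⟩ := exists_enum Q
  refine ⟨(Finset.range k).image e, by simp [Finset.card_image_of_injective _ he], ?_⟩
  rw [Finset.sum_image he.injOn, topSum_eq_sum_range]
  simp [hd]

/-- The threshold `s = decr Q (k + 1)` separates the masses inside `E` from those outside. Hence `E`
maximizes the sum of `Q x - s` over finite sets, and `s ≥ 0` absorbs the difference in cardinality.
-/
theorem sum_le_topSum (Q : PMF ℕ+) {k : ℕ} (T : Finset ℕ+) (hT : T.card ≤ k) :
    ∑ x ∈ T, (Q x).toReal ≤ topSum Q k := by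
  classical
  obtain ⟨e, he, hd, -, hmax⟩ := exists_enum Q
  set E := (Finset.range k).image e with hE
  set s := decr Q (k + 1) with hs
  have hsum : topSum Q k = ∑ x ∈ E, (Q x).toReal := by
    rw [Finset.sum_image he.injOn, topSum_eq_sum_range]
    simp [hd]
  have hcard : E.card = k := by simp [hE, Finset.card_image_of_injective _ he]
  have hin : ∀ x ∈ E, 0 ≤ (Q x).toReal - s := by
    intro x hx
    obtain ⟨n, hn, rfl⟩ := Finset.mem_image.1 hx
    rw [← hd, sub_nonneg]
    exact decr_anti Q (by omega) (by have := Finset.mem_range.1 hn; omega)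
  have hout : ∀ x ∉ E, (Q x).toReal - s ≤ 0 := by
    intro x hx
    have := hmax k x hx
    rw [hs, hd]
    linarith
  have h1 : ∑ x ∈ T, ((Q x).toReal - s) ≤ ∑ x ∈ E, ((Q x).toReal - s) := by
    calc ∑ x ∈ T, ((Q x).toReal - s) ≤ ∑ x ∈ T ∩ E, ((Q x).toReal - s) := by
          rw [← Finset.sum_inter_add_sum_sdiff T E]
          have : ∑ x ∈ T \ E, ((Q x).toReal - s) ≤ 0 :=
            Finset.sum_nonpos fun x hx => hout x (Finset.mem_sdiff.1 hx).2
          linarith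
      _ ≤ _ := Finset.sum_le_sum_of_subset_of_nonneg Finset.inter_subset_right
          fun x hx _ => hin x hx
  simp only [Finset.sum_sub_distrib, Finset.sum_const, nsmul_eq_mul, hcard] at h1
  have h2 : (T.card : ℝ) * s ≤ k * s :=
    mul_le_mul_of_nonneg_right (by exact_mod_cast hT) (decr_nonneg Q _)
  rw [hsum]
  linarith

theorem topSum_le_one (Q : PMF ℕ+) (k : ℕ) : topSum Q k ≤ 1 := by
  obtain ⟨T, -, hT⟩ := exists_card_eq_topSum Q k
  rw [← hT]
  exact sum_le_hasSum _ (fun _ _ => ENNReal.toReal_nonneg) (hasSum_toReal Q)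

theorem decr_one_pos (Q : PMF ℕ+) : 0 < decr Q 1 := by
  by_contra! h
  have : (fun x : ℕ+ => decr Q x) = fun _ => 0 := by
    funext x
    exact le_antisymm ((decr_anti Q le_rfl x.pos).trans h) (decr_nonneg Q _)
  have h1 := hasSum_decr Q
  rw [this] at h1
  exact zero_ne_one (hasSum_zero.unique h1)

theorem tendsto_decr (Q : PMF ℕ+) :
    Filter.Tendsto (fun n : ℕ => decr Q (n + 1)) Filter.atTop (nhds 0) := by
  obtain ⟨e, he, hd, -, -⟩ := exists_enum Q
  simp only [hd]
  have := (hasSum_toReal Q).summable.tendsto_cofinite_zero.comp he.tendsto_cofinite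
  rwa [Nat.cofinite_eq_atTop] at this

theorem exists_lt_decr_iff (Q : PMF ℕ+) {s : ℝ} (hs : 0 < s) :
    ∃ n : ℕ, ∀ i, 1 ≤ i → (s < decr Q i ↔ i ≤ n) := by
  have hex : ∃ n : ℕ, decr Q (n + 1) ≤ s := by
    obtain ⟨n, hn⟩ := ((tendsto_decr Q).eventually (gt_mem_nhds hs)).exists
    exact ⟨n, hn.le⟩
  classical
  refine ⟨Nat.find hex, fun i hi => ⟨fun h => ?_, fun h => ?_⟩⟩
  · by_contra! hlt
    exact absurd ((decr_anti Q (by omega) hlt).trans (Nat.find_spec hex)) (not_le.2 h)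
  · have := Nat.find_min hex (m := i - 1) (by omega)
    rw [Nat.sub_add_cancel hi] at this
    exact not_le.1 this

/-- Outside a set with at most `n` elements there are `j` symbols carrying at least the mass of the
symbols of rank `n + 1, …, n + j`. -/
theorem exists_disjoint_topSum (Q : PMF ℕ+) (A : Finset ℕ+) {n : ℕ} (hA : A.card ≤ n) (j : ℕ) :
    ∃ B : Finset ℕ+, B.card = j ∧ Disjoint A B ∧
      topSum Q (n + j) - topSum Q n ≤ ∑ x ∈ B, (Q x).toReal := by
  classical
  obtain ⟨E, hE, hsum⟩ := exists_card_eq_topSum Q (n + j)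
  have hcard : j ≤ (E \ A).card := by
    have := Finset.le_card_sdiff A E
    omega
  obtain ⟨B, hB, hBj⟩ := Finset.exists_subset_card_eq hcard
  have hBE : B ⊆ E := hB.trans Finset.sdiff_subset
  refine ⟨B, hBj, ?_, ?_⟩
  · exact (Finset.disjoint_of_subset_left hB Finset.sdiff_disjoint).symm
  -- Removing `B` from the top `n + j` symbols leaves exactly `n` of them.
  · have h1 := sum_le_topSum Q (k := n) (E \ B) (by rw [Finset.card_sdiff_of_subset hBE]; omega)
    have h2 := Finset.sum_sdiff (f := fun x => (Q x).toReal) hBE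
    linarith

/-! ### The cut points `J` and `K₂` -/

section Structure

variable {Q : PMF ℕ+} {L : ℕ} {ε : ℝ} {m : ℕ}

/-- For `m = 0` the assumption would give `1 ≤ ε ≤ 1 - topSum Q L < 1`. -/
theorem Admissible.one_le (hL : 1 ≤ L) (h : Admissible Q L ε m) : 1 ≤ m := by
  rcases Nat.eq_zero_or_pos m with rfl | hm
  · obtain ⟨h1, h2⟩ := h
    rw [Nat.zero_mul, topSum_zero] at h1
    have h3 := topSum_mono Q hL
    have h4 := topSum_succ Q 0
    rw [topSum_zero] at h4
    have := decr_one_pos Q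
    norm_num at h4
    linarith
  · exact hm

theorem V_of_le {j : ℕ} (hj : j ≤ L) :
    V Q L ε j * ((L : ℝ) - j + 1) = (1 - ε) - topSum Q (j - 1) := by
  have : (j : ℝ) ≤ L := by exact_mod_cast hj
  rw [V, if_pos hj, div_mul_cancel₀]
  linarith

theorem W_of_lt {k : ℕ} (hk : L < k) :
    W Q L ε k * ((k : ℝ) - L) = topSum Q k - (1 - ε) := by
  have : (L : ℝ) < k := by exact_mod_cast hk
  rw [W, if_neg hk.ne', div_mul_cancel₀]
  linarith

/-- Since `V = 1` beyond `L`, this puts `L + 1` into the set whose minimum is `J`. -/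
theorem decr_succ_lt_one (hL : 1 ≤ L) : decr Q (L + 1) < 1 := by
  have h1 := topSum_succ Q L
  have h2 := topSum_le_one Q (L + 1)
  have h3 := topSum_mono Q hL
  have h4 := topSum_succ Q 0
  rw [topSum_zero] at h4
  have := decr_one_pos Q
  norm_num at h4
  linarith

theorem J_spec (hL : 1 ≤ L) :
    1 ≤ J Q L ε ∧ decr Q (J Q L ε) < V Q L ε (J Q L ε) ∧ J Q L ε ≤ L + 1 := by
  have hmem : L + 1 ∈ {j : ℕ | 1 ≤ j ∧ decr Q j < V Q L ε j} := by
    refine ⟨by omega, ?_⟩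
    rw [V, if_neg (by omega)]
    exact decr_succ_lt_one hL
  have h := Nat.sInf_mem ⟨_, hmem⟩
  exact ⟨h.1, h.2, Nat.sInf_le hmem⟩

theorem V_le_decr_of_lt_J {j : ℕ} (h1 : 1 ≤ j) (hj : j < J Q L ε) : V Q L ε j ≤ decr Q j := by
  by_contra! h
  exact Nat.notMem_of_lt_sInf hj ⟨h1, h⟩

theorem K₂_spec (hm : 1 ≤ m) :
    (L ≤ K₂ Q L ε m ∧ K₂ Q L ε m ≤ m * L ∧ W Q L ε (K₂ Q L ε m) < decr Q (K₂ Q L ε m)) ∧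
      ∀ k, K₂ Q L ε m < k → k ≤ m * L → decr Q k ≤ W Q L ε k := by
  have hbdd : BddAbove {k : ℕ | L ≤ k ∧ k ≤ m * L ∧ W Q L ε k < decr Q k} :=
    ⟨m * L, fun k hk => hk.2.1⟩
  have hmem : L ∈ {k : ℕ | L ≤ k ∧ k ≤ m * L ∧ W Q L ε k < decr Q k} := by
    refine ⟨le_rfl, Nat.le_mul_of_pos_left _ hm, ?_⟩
    -- The convention `W = -1` at `L` keeps the set defining `K₂` nonempty.
    rw [W, if_pos rfl]
    linarith [decr_nonneg Q L]
  have h := Nat.sSup_mem ⟨_, hmem⟩ hbdd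
  refine ⟨h, fun k hk hkm => ?_⟩
  by_contra! hlt
  have hle : k ≤ K₂ Q L ε m := le_csSup hbdd ⟨(h.1.trans_lt hk).le, hkm, hlt⟩
  omega

/-- If the `L` largest masses have total mass `1 - ε`, both plateaus are empty. -/
theorem J_K₂_of_topSum_eq (hL : 1 ≤ L) (hm : 1 ≤ m) (h : topSum Q L = 1 - ε) :
    J Q L ε = L + 1 ∧ K₂ Q L ε m = L := by
  constructor
  · obtain ⟨h1, h2, h3⟩ := J_spec (Q := Q) (ε := ε) hL
    by_contra hne
    have hle : J Q L ε ≤ L := by omega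
    have hV := V_of_le (Q := Q) (ε := ε) hle
    -- By monotonicity the ranks `J, …, L` weigh at most `L - J + 1` times `decr Q J`, which is less
    -- than `1 - ε - topSum Q (J - 1)`; this contradicts `h`.
    have hcard : topSum Q L - topSum Q (J Q L ε - 1) ≤
        decr Q (J Q L ε) * ((L : ℝ) - J Q L ε + 1) := by
      have key : ∀ n, topSum Q (J Q L ε - 1 + n) - topSum Q (J Q L ε - 1) ≤
          decr Q (J Q L ε) * n := by
        intro n
        induction n with
        | zero => simp
        | succ n ih =>
          rw [← Nat.add_assoc, topSum_succ]
          push_cast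
          have := decr_anti Q h1 (j := J Q L ε - 1 + n + 1) (by omega)
          linarith
      have := key (L + 1 - J Q L ε)
      rw [show J Q L ε - 1 + (L + 1 - J Q L ε) = L by omega, Nat.cast_sub (by omega)] at this
      push_cast at this
      linarith
    have hpos : (0 : ℝ) < (L : ℝ) - J Q L ε + 1 := by
      have : (J Q L ε : ℝ) ≤ L := by exact_mod_cast hle
      linarith
    have := mul_lt_mul_of_pos_right h2 hpos
    linarith
  · obtain ⟨⟨h1, h2, h3⟩, -⟩ := K₂_spec (Q := Q) (L := L) (ε := ε) hm
    by_contra hne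
    have hlt : L < K₂ Q L ε m := by omega
    have hW := W_of_lt (Q := Q) (ε := ε) hlt
    have key : ∀ n, L + n ≤ K₂ Q L ε m →
        decr Q (K₂ Q L ε m) * n ≤ topSum Q (L + n) - topSum Q L := by
      intro n
      induction n with
      | zero => simp
      | succ n ih =>
        intro hn
        have := ih (by omega)
        rw [← Nat.add_assoc, topSum_succ]
        push_cast
        have := decr_anti Q (i := L + n + 1) (j := K₂ Q L ε m) (by omega) (by omega)
        linarith
    have := key (K₂ Q L ε m - L) (by omega)
    rw [Nat.add_sub_cancel' h1, Nat.cast_sub h1] at this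
    have hpos : (0 : ℝ) < (K₂ Q L ε m : ℝ) - L := by
      have : (L : ℝ) < K₂ Q L ε m := by exact_mod_cast hlt
      linarith
    have := mul_lt_mul_of_pos_right h3 hpos
    linarith

/-- The position of the two plateaus when the `L` largest masses have total mass `< 1 - ε`. -/
structure Plateaus (Q : PMF ℕ+) (L : ℕ) (ε : ℝ) (m : ℕ) : Prop where
  one_le_J : 1 ≤ J Q L ε
  J_le : J Q L ε ≤ L
  lt_K₂ : L < K₂ Q L ε m
  K₂_le : K₂ Q L ε m ≤ m * L
  decr_lt_V : decr Q (J Q L ε) < V Q L ε (J Q L ε)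
  V_le_decr : ∀ j, 1 ≤ j → j < J Q L ε → V Q L ε (J Q L ε) ≤ decr Q j
  W_lt_decr : W Q L ε (K₂ Q L ε m) < decr Q (K₂ Q L ε m)
  W_nonneg : 0 ≤ W Q L ε (K₂ Q L ε m)
  decr_le_W : K₂ Q L ε m < m * L → decr Q (K₂ Q L ε m + 1) ≤ W Q L ε (K₂ Q L ε m)
  V_mul : ((L : ℝ) - J Q L ε + 1) * V Q L ε (J Q L ε) = (1 - ε) - topSum Q (J Q L ε - 1)
  W_mul : ((K₂ Q L ε m : ℝ) - L) * W Q L ε (K₂ Q L ε m) = topSum Q (K₂ Q L ε m) - (1 - ε)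

/-- Strictness says that `V` at `L` exceeds `decr Q L` and `W` at `L + 1` is below `decr Q (L + 1)`,
so both plateaus are nonempty; `m * L = L` would contradict admissibility. -/
theorem Admissible.plateaus (hL : 1 ≤ L) (h : Admissible Q L ε m) (hlt : topSum Q L < 1 - ε) :
    Plateaus Q L ε m := by
  have hm := h.one_le hL
  obtain ⟨h1, h2, h3⟩ := J_spec (Q := Q) (ε := ε) hL
  obtain ⟨⟨k1, k2, k3⟩, kmax⟩ := K₂_spec (Q := Q) (L := L) (ε := ε) hm
  have hJL : J Q L ε ≤ L := by
    by_contra hne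
    have hV := V_of_le (Q := Q) (ε := ε) (le_refl L)
    have h4 := V_le_decr_of_lt_J (Q := Q) (ε := ε) hL (show L < J Q L ε by omega)
    have h5 := topSum_succ Q (L - 1)
    rw [Nat.sub_add_cancel hL] at h5
    norm_num at hV
    linarith
  have hV := V_of_le (Q := Q) (ε := ε) hJL
  have hpos : (0 : ℝ) < (L : ℝ) - J Q L ε + 1 := by
    have : (J Q L ε : ℝ) ≤ L := by exact_mod_cast hJL
    linarith
  have hLK : L < K₂ Q L ε m := by
    by_contra hne
    have hK : K₂ Q L ε m = L := by omega
    by_cases hm1 : m * L = L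
    · have := h.1
      rw [hm1] at this
      linarith
    · have hmL : L < m * L := lt_of_le_of_ne (Nat.le_mul_of_pos_left _ hm) (Ne.symm hm1)
      have h4 := kmax (L + 1) (by omega) (by omega)
      have hW := W_of_lt (Q := Q) (ε := ε) (Nat.lt_succ_self L)
      have h5 := topSum_succ Q L
      push_cast at hW
      norm_num at hW
      linarith
  have hW := W_of_lt (Q := Q) (ε := ε) hLK
  have hposK : (0 : ℝ) < (K₂ Q L ε m : ℝ) - L := by
    have : (L : ℝ) < K₂ Q L ε m := by exact_mod_cast hLK
    linarith
  have hnext : K₂ Q L ε m < m * L → decr Q (K₂ Q L ε m + 1) ≤ W Q L ε (K₂ Q L ε m) := by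
    intro hlt'
    have h4 := kmax (K₂ Q L ε m + 1) (by omega) (by omega)
    have hW' := W_of_lt (Q := Q) (ε := ε) (show L < K₂ Q L ε m + 1 by omega)
    have h5 := topSum_succ Q (K₂ Q L ε m)
    push_cast at hW'
    -- With `K = K₂`, `(K + 1 - L) W(K + 1) = (K - L) W(K) + decr Q (K + 1)`, so `decr Q (K + 1) ≤
    -- W(K + 1)` passes to `W(K)`.
    have h6 := mul_le_mul_of_nonneg_right h4
      (show (0 : ℝ) ≤ (K₂ Q L ε m : ℝ) + 1 - L by linarith)
    refine le_of_mul_le_mul_right ?_ hposK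
    linarith
  refine ⟨h1, hJL, hLK, k2, h2, fun j hj hjJ => ?_, k3, ?_, hnext, by rw [← hV]; ring,
    by rw [← hW]; ring⟩
  -- Only the rank `J - 1` matters. There `(L - J + 2) V(J - 1) = (L - J + 1) V(J) + decr Q (J - 1)`
  -- turns `V(J - 1) ≤ decr Q (J - 1)` into the same bound for `V(J)`.
  · refine le_trans ?_ (decr_anti Q hj (show j ≤ J Q L ε - 1 by omega))
    have h4 := V_le_decr_of_lt_J (Q := Q) (L := L) (ε := ε) (j := J Q L ε - 1)
      (by omega) (by omega)
    have hV' := V_of_le (Q := Q) (ε := ε) (show J Q L ε - 1 ≤ L by omega)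
    have h5 := topSum_succ Q (J Q L ε - 1 - 1)
    rw [Nat.sub_add_cancel (by omega)] at h5
    rw [Nat.cast_sub h1] at hV'
    push_cast at hV'
    have h6 := mul_le_mul_of_nonneg_right h4
      (show (0 : ℝ) ≤ (L : ℝ) - (J Q L ε - 1) + 1 by linarith)
    refine le_of_mul_le_mul_right ?_ hpos
    linarith
  · rcases lt_or_eq_of_le k2 with hlt' | heq
    · exact (decr_nonneg _ _).trans (hnext hlt')
    · have := h.1
      rw [heq] at hW ⊢
      rw [heq] at hposK
      refine nonneg_of_mul_nonneg_left (b := ((m * L : ℕ) : ℝ) - L) ?_ hposK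
      rw [hW]
      linarith

theorem Plateaus.V_pos (h : Plateaus Q L ε m) : 0 < V Q L ε (J Q L ε) :=
  (decr_nonneg _ _).trans_lt h.decr_lt_V

theorem Plateaus.W_le_V (h : Plateaus Q L ε m) :
    W Q L ε (K₂ Q L ε m) ≤ V Q L ε (J Q L ε) :=
  h.W_lt_decr.le.trans
    ((decr_anti Q h.one_le_J (h.J_le.trans h.lt_K₂.le)).trans h.decr_lt_V.le)

end Structure

/-! ### The Fano-distribution of type 2 -/

section Fano

variable {Q : PMF ℕ+} {L : ℕ} {ε : ℝ} {m : ℕ}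

/-- The mass function of the Fano-distribution of type 2 at a natural number. -/
noncomputable def fanoNat (Q : PMF ℕ+) (L : ℕ) (ε : ℝ) (m : ℕ) (x : ℕ) : ℝ :=
  if x < J Q L ε ∨ K₂ Q L ε m < x then decr Q x
  else if x ≤ L then V Q L ε (J Q L ε)
  else W Q L ε (K₂ Q L ε m)

theorem fanoType2_eq_fanoNat (x : ℕ+) : fanoType2 Q L ε m x = fanoNat Q L ε m x := rfl

theorem fanoType2_of_topSum_eq (hL : 1 ≤ L) (hm : 1 ≤ m) (h : topSum Q L = 1 - ε) (x : ℕ+) :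
    fanoType2 Q L ε m x = decr Q x := by
  obtain ⟨hJ, hK⟩ := J_K₂_of_topSum_eq (ε := ε) hL hm h
  rw [fanoType2, if_pos]
  omega

theorem sum_fanoNat_of_lt_J {k : ℕ} (hk : k < J Q L ε) :
    ∑ i ∈ Finset.range k, fanoNat Q L ε m (i + 1) = topSum Q k := by
  rw [topSum_eq_sum_range]
  refine Finset.sum_congr rfl fun i hi => ?_
  rw [fanoNat, if_pos]
  have := Finset.mem_range.1 hi
  omega

/-- The value `V` is normalized so that the first `L` places hold `1 - ε`; likewise `W` restores the
partial sum of `Q↓` at `K₂`. -/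
theorem Plateaus.sum_fanoNat_L (h : Plateaus Q L ε m) :
    ∑ i ∈ Finset.range L, fanoNat Q L ε m (i + 1) = 1 - ε := by
  have h1 := h.one_le_J
  have h2 := h.J_le
  have h3 := h.lt_K₂
  rw [← Finset.sum_range_add_sum_Ico _ (show J Q L ε - 1 ≤ L by omega),
    sum_fanoNat_of_lt_J (by omega), Finset.sum_congr (g := fun _ => V Q L ε (J Q L ε)) rfl]
  · rw [Finset.sum_const, Nat.card_Ico, nsmul_eq_mul, Nat.cast_sub (by omega), Nat.cast_sub h1]
    have := h.V_mul
    push_cast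
    linarith
  · intro i hi
    have := Finset.mem_Ico.1 hi
    rw [fanoNat, if_neg (by omega), if_pos (by omega)]

theorem Plateaus.sum_fanoNat_K₂ (h : Plateaus Q L ε m) :
    ∑ i ∈ Finset.range (K₂ Q L ε m), fanoNat Q L ε m (i + 1) = topSum Q (K₂ Q L ε m) := by
  have h1 := h.one_le_J
  have h2 := h.J_le
  have h3 := h.lt_K₂
  rw [← Finset.sum_range_add_sum_Ico _ h3.le,
    h.sum_fanoNat_L, Finset.sum_congr (g := fun _ => W Q L ε (K₂ Q L ε m)) rfl]
  · rw [Finset.sum_const, Nat.card_Ico, nsmul_eq_mul, Nat.cast_sub (by omega)]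
    have := h.W_mul
    linarith
  · intro i hi
    have := Finset.mem_Ico.1 hi
    rw [fanoNat, if_neg (by omega), if_neg (by omega)]

theorem sum_Ico_fanoNat {n : ℕ} (hn : K₂ Q L ε m ≤ n) :
    ∑ i ∈ Finset.Ico (K₂ Q L ε m) n, fanoNat Q L ε m (i + 1) =
      topSum Q n - topSum Q (K₂ Q L ε m) := by
  rw [topSum_eq_sum_range, topSum_eq_sum_range, ← Finset.sum_Ico_eq_sub _ hn]
  refine Finset.sum_congr rfl fun i hi => ?_
  have := Finset.mem_Ico.1 hi
  rw [fanoNat, if_pos (by omega)]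

theorem Plateaus.sum_fanoNat (h : Plateaus Q L ε m) {n : ℕ} (hn : K₂ Q L ε m ≤ n) :
    ∑ i ∈ Finset.range n, fanoNat Q L ε m (i + 1) = topSum Q n := by
  rw [← Finset.sum_range_add_sum_Ico _ hn, h.sum_fanoNat_K₂, sum_Ico_fanoNat hn]
  ring

theorem fanoType2_nonneg (hL : 1 ≤ L) (hsys : Admissible Q L ε m) (x : ℕ+) :
    0 ≤ fanoType2 Q L ε m x := by
  have hle : topSum Q L ≤ 1 - ε := by linarith [hsys.2]
  rcases hle.eq_or_lt with heq | hlt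
  · rw [fanoType2_of_topSum_eq hL (hsys.one_le hL) heq]
    exact decr_nonneg _ _
  · have h := hsys.plateaus hL hlt
    rw [fanoType2]
    split_ifs
    · exact decr_nonneg _ _
    · exact h.V_pos.le
    · exact h.W_nonneg

theorem hasSum_fanoType2 (hL : 1 ≤ L) (hsys : Admissible Q L ε m) :
    HasSum (fanoType2 Q L ε m) 1 := by
  have hle : topSum Q L ≤ 1 - ε := by linarith [hsys.2]
  rcases hle.eq_or_lt with heq | hlt
  · rw [funext (fanoType2_of_topSum_eq hL (hsys.one_le hL) heq)]
    exact hasSum_decr Q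
  · have h := hsys.plateaus hL hlt
    -- The two mass functions differ only at places up to `K₂`, where their partial sums agree.
    have h1 : HasSum (fun n : ℕ => fanoNat Q L ε m (n + 1) - decr Q (n + 1)) 0 := by
      have : HasSum (fun n : ℕ => fanoNat Q L ε m (n + 1) - decr Q (n + 1))
          (∑ n ∈ Finset.range (K₂ Q L ε m), (fanoNat Q L ε m (n + 1) - decr Q (n + 1))) :=
        hasSum_sum_of_ne_finset_zero fun n hn => by
          simp only [Finset.mem_range, not_lt] at hn
          rw [fanoNat, if_pos (by omega), sub_self]
      rwa [Finset.sum_sub_distrib, h.sum_fanoNat_K₂, ← topSum_eq_sum_range, sub_self] at this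
    have h2 : HasSum (fun x : ℕ+ => fanoNat Q L ε m x - decr Q x) 0 := by
      rw [← Equiv.pnatEquivNat.symm.hasSum_iff]
      exact h1
    rw [funext (fanoType2_eq_fanoNat (Q := Q) (L := L) (ε := ε) (m := m))]
    simpa using h2.add (hasSum_decr Q)

end Fano

/-! ### Excess over a threshold -/

/-- The total mass of `f` in excess of the threshold `s`. -/
noncomputable def hinge (f : ℕ+ → ℝ) (s : ℝ) : ℝ≥0∞ := ∑' x, ENNReal.ofReal (f x - s)

theorem hinge_eq_tsum_nat (f : ℕ → ℝ) (s : ℝ) :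
    hinge (fun x => f x) s = ∑' n : ℕ, ENNReal.ofReal (f (n + 1) - s) :=
  tsum_pnat_eq_tsum_succ (f := fun n => ENNReal.ofReal (f n - s))

/-- Places with value exactly `s` contribute nothing, so `T` may contain any of them. With
`le_hinge`, comparing excesses reduces to comparing the sum over `T` with a single partial sum. -/
theorem hinge_eq_of_level_set (f : ℕ → ℝ) (s : ℝ) (T : Finset ℕ)
    (hin : ∀ n ∈ T, s ≤ f (n + 1)) (hout : ∀ n ∉ T, f (n + 1) ≤ s) :
    hinge (fun x => f x) s = ENNReal.ofReal (∑ n ∈ T, f (n + 1) - T.card * s) := by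
  rw [hinge_eq_tsum_nat, tsum_eq_sum (s := T) fun n hn =>
    ENNReal.ofReal_of_nonpos (sub_nonpos.2 (hout n hn)),
    ← ENNReal.ofReal_sum_of_nonneg fun n hn => sub_nonneg.2 (hin n hn)]
  simp [Finset.sum_sub_distrib]

theorem le_hinge (f : ℕ → ℝ) (s : ℝ) (k : ℕ) :
    ENNReal.ofReal (∑ n ∈ Finset.range k, f (n + 1) - k * s) ≤ hinge (fun x => f x) s := by
  rw [hinge_eq_tsum_nat]
  calc ENNReal.ofReal (∑ n ∈ Finset.range k, f (n + 1) - k * s)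
      = ENNReal.ofReal (∑ n ∈ Finset.range k, (f (n + 1) - s)) := by
        simp [Finset.sum_sub_distrib]
    _ ≤ ENNReal.ofReal (∑ n ∈ Finset.range k, max (f (n + 1) - s) 0) :=
        ENNReal.ofReal_le_ofReal (Finset.sum_le_sum fun n _ => le_max_left _ _)
    _ = ∑ n ∈ Finset.range k, ENNReal.ofReal (f (n + 1) - s) := by
        rw [ENNReal.ofReal_sum_of_nonneg fun n _ => le_max_right _ _]
        refine Finset.sum_congr rfl fun n _ => ?_
        rcases le_total (f (n + 1) - s) 0 with h | h
        · rw [max_eq_right h, ENNReal.ofReal_of_nonpos h, ENNReal.ofReal_zero]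
        · rw [max_eq_left h]
    _ ≤ _ := ENNReal.sum_le_tsum _

/-- The Fano-distribution of type 2 is majorized by every mass function whose partial sums
dominate those of the decreasing rearrangement and those arising from `m` lists of length `L`. -/
theorem hinge_fanoType2_le {Q : PMF ℕ+} {L : ℕ} {ε : ℝ} {m : ℕ} (hL : 1 ≤ L)
    (hsys : Admissible Q L ε m) (p : ℕ → ℝ)
    (h1 : ∀ k, topSum Q k ≤ ∑ n ∈ Finset.range k, p (n + 1))
    (h2 : ∀ j, 1 - ε + (topSum Q (m * L + j) - topSum Q (m * L)) ≤
      ∑ n ∈ Finset.range (L + j), p (n + 1))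
    {s : ℝ} (hs : 0 < s) :
    hinge (fanoType2 Q L ε m) s ≤ hinge (fun x => p x) s := by
  obtain ⟨n, hn⟩ := exists_lt_decr_iff Q hs
  have hle : topSum Q L ≤ 1 - ε := by linarith [hsys.2]
  have key : ∀ (f : ℕ → ℝ) (T : Finset ℕ) (k : ℕ), T.card = k →
      (∀ i ∈ T, s ≤ f (i + 1)) → (∀ i ∉ T, f (i + 1) ≤ s) →
      ∑ i ∈ T, f (i + 1) ≤ ∑ i ∈ Finset.range k, p (i + 1) →
      hinge (fun x => f x) s ≤ hinge (fun x => p x) s := by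
    intro f T k hk hin hout hsum
    rw [hinge_eq_of_level_set f s T hin hout]
    refine le_trans (ENNReal.ofReal_le_ofReal ?_) (le_hinge p s k)
    rw [hk]
    linarith
  have hdn : ∀ i, i < n → s < decr Q (i + 1) := fun i hi => (hn _ (by omega)).2 hi
  have hdn' : ∀ i, n ≤ i → decr Q (i + 1) ≤ s := fun i hi => by
    by_contra! hlt
    have := (hn _ (by omega)).1 hlt
    omega
  rcases hle.eq_or_lt with heq | hlt
  · rw [funext (fanoType2_of_topSum_eq hL (hsys.one_le hL) heq)]
    refine key (decr Q) (Finset.range n) n (by simp)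
      (fun i hi => (hdn i (Finset.mem_range.1 hi)).le)
      (fun i hi => hdn' i (by simpa using hi)) ?_
    rw [← topSum_eq_sum_range]
    exact h1 n
  have h := hsys.plateaus hL hlt
  have hJ1 := h.one_le_J
  have hJL := h.J_le
  have hLK := h.lt_K₂
  have hWV := h.W_le_V
  rw [funext (fanoType2_eq_fanoNat (Q := Q) (L := L) (ε := ε) (m := m))]
  rcases le_or_gt (V Q L ε (J Q L ε)) s with hVs | hsV
  -- Here `n` counts the masses of `Q` above `s`. When `s` is at least the upper plateau, the level
  -- set is the first `n` places, all before `J`.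
  · have hnJ : n < J Q L ε := by
      by_contra! hge
      have := (hn _ hJ1).2 hge
      linarith [h.decr_lt_V]
    refine key (fanoNat Q L ε m) (Finset.range n) n (by simp) ?_ ?_ ?_
    · intro i hi
      have hi := Finset.mem_range.1 hi
      rw [fanoNat, if_pos (by omega)]
      exact (hdn i hi).le
    · intro i hi
      rw [fanoNat]
      split_ifs
      · exact hdn' i (by simpa using hi)
      · exact hVs
      · exact hWV.trans hVs
    · rw [sum_fanoNat_of_lt_J hnJ]
      exact h1 n
  have hJn : J Q L ε ≤ n + 1 := by
    by_contra! hge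
    have := h.V_le_decr (n + 1) (by omega) hge
    have := hdn' n le_rfl
    linarith
  rcases le_or_gt n (K₂ Q L ε m) with hnK | hKn
  · rcases le_or_gt (W Q L ε (K₂ Q L ε m)) s with hWs | hsW
    -- The threshold separates the plateaus: the level set is the first `L` places, of total `1 -
    -- ε`, and the list bound with `j = 0` applies.
    · refine key (fanoNat Q L ε m) (Finset.range L) L (by simp) ?_ ?_ ?_
      · intro i hi
        have hi := Finset.mem_range.1 hi
        rw [fanoNat]
        split_ifs
        · exact (hdn i (by omega)).le
        · exact hsV.le
        · omega
      · intro i hi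
        have hi : L ≤ i := by simpa using hi
        rw [fanoNat]
        split_ifs
        · exact hdn' i (by omega)
        · omega
        · exact hWs
      · rw [h.sum_fanoNat_L]
        simpa using h2 0
    · have hKn : K₂ Q L ε m ≤ n := (hn _ (by omega)).1 (hsW.trans h.W_lt_decr)
      obtain rfl : n = K₂ Q L ε m := by omega
      refine key (fanoNat Q L ε m) (Finset.range (K₂ Q L ε m)) _ (Finset.card_range _) ?_ ?_ ?_
      · intro i hi
        have hi := Finset.mem_range.1 hi
        rw [fanoNat]
        split_ifs
        · exact (hdn i (by omega)).le
        · exact hsV.le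
        · exact hsW.le
      · intro i hi
        have hi : K₂ Q L ε m ≤ i := by simpa using hi
        rw [fanoNat, if_pos (by omega)]
        exact hdn' i (by omega)
      · rw [h.sum_fanoNat_K₂]
        exact h1 _
  · rcases le_or_gt (W Q L ε (K₂ Q L ε m)) s with hWs | hsW
    -- The one case where the level set is not an initial segment: masses beyond `K₂` exceed `s`
    -- although the lower plateau does not. This forces `K₂ = m * L`, and the list bound is used
    -- with `j = n - K₂`.
    · have hK : K₂ Q L ε m = m * L := by
        by_contra hne
        have h4 := h.decr_le_W (lt_of_le_of_ne h.K₂_le hne)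
        have := hdn (K₂ Q L ε m) hKn
        linarith
      have hdisj : Disjoint (Finset.range L) (Finset.Ico (K₂ Q L ε m) n) := by
        rw [Finset.disjoint_left]
        intro i hi
        have := Finset.mem_range.1 hi
        simp only [Finset.mem_Ico, not_and]
        omega
      refine key (fanoNat Q L ε m) (Finset.range L ∪ Finset.Ico (K₂ Q L ε m) n)
        (L + (n - K₂ Q L ε m)) ?_ ?_ ?_ ?_
      · rw [Finset.card_union_of_disjoint hdisj]
        simp
      · intro i hi
        simp only [Finset.mem_union, Finset.mem_range, Finset.mem_Ico] at hi
        rw [fanoNat]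
        split_ifs
        · exact (hdn i (by omega)).le
        · exact hsV.le
        · omega
      · intro i hi
        simp only [Finset.mem_union, Finset.mem_range, Finset.mem_Ico] at hi
        rw [fanoNat]
        split_ifs
        · exact hdn' i (by omega)
        · omega
        · exact hWs
      · rw [Finset.sum_union hdisj, h.sum_fanoNat_L, sum_Ico_fanoNat hKn.le]
        have := h2 (n - K₂ Q L ε m)
        rw [← hK, Nat.add_sub_cancel' hKn.le] at this
        exact this
    · refine key (fanoNat Q L ε m) (Finset.range n) _ (Finset.card_range _) ?_ ?_ ?_
      · intro i hi
        have hi := Finset.mem_range.1 hi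
        rw [fanoNat]
        split_ifs
        · exact (hdn i (by omega)).le
        · exact hsV.le
        · exact hsW.le
      · intro i hi
        have hi : n ≤ i := by simpa using hi
        rw [fanoNat, if_pos (by omega)]
        exact hdn' i (by omega)
      · rw [h.sum_fanoNat hKn.le]
        exact h1 _

/-! ### Comparison of power sums and entropies from comparison of excesses -/

/-- Taylor's formula at `0` with integral remainder; the weight is the second derivative of `s ^ α`.
-/
theorem ofReal_rpow_eq_lintegral_hinge {α t : ℝ} (hα : 1 < α) (ht : 0 ≤ t) :
    ENNReal.ofReal (t ^ α) =
      ∫⁻ s in Set.Ioi (0 : ℝ), ENNReal.ofReal (α * (α - 1) * s ^ (α - 2)) *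
        ENNReal.ofReal (t - s) := by
  have hsplit : Set.Ioi (0 : ℝ) = Set.Ioc 0 t ∪ Set.Ioi t := (Set.Ioc_union_Ioi_eq_Ioi ht).symm
  have hint : IntervalIntegrable (fun s : ℝ => α * (α - 1) * t * s ^ (α - 2)
      - α * (α - 1) * s ^ (α - 1)) volume 0 t :=
    ((intervalIntegral.intervalIntegrable_rpow' (by linarith)).const_mul _).sub
      ((intervalIntegral.intervalIntegrable_rpow' (by linarith)).const_mul _)
  have hval : ∫ s in (0 : ℝ)..t, (α * (α - 1) * t * s ^ (α - 2)
      - α * (α - 1) * s ^ (α - 1)) = t ^ α := by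
    rw [intervalIntegral.integral_sub
      ((intervalIntegral.intervalIntegrable_rpow' (by linarith)).const_mul _)
      ((intervalIntegral.intervalIntegrable_rpow' (by linarith)).const_mul _),
      intervalIntegral.integral_const_mul, intervalIntegral.integral_const_mul,
      integral_rpow (Or.inl (by linarith)), integral_rpow (Or.inl (by linarith)),
      show α - 2 + 1 = α - 1 by ring, show α - 1 + 1 = α by ring,
      Real.zero_rpow (by linarith), Real.zero_rpow (by linarith)]
    have h1 : t * t ^ (α - 1) = t ^ α := by
      rw [← Real.rpow_one_add' ht (by linarith)]
      congr 1
      ring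
    have : α - 1 ≠ 0 := by linarith
    have : α ≠ 0 := by linarith
    calc α * (α - 1) * t * ((t ^ (α - 1) - 0) / (α - 1)) - α * (α - 1) * ((t ^ α - 0) / α)
        = α * (t * t ^ (α - 1)) - (α - 1) * t ^ α := by
          rw [sub_zero, sub_zero]
          field_simp
      _ = t ^ α := by rw [h1]; ring
  rw [hsplit, lintegral_union measurableSet_Ioi
    (Set.disjoint_left.2 fun x hx hx' => not_lt.2 hx.2 hx')]
  have hzero : ∫⁻ s in Set.Ioi t, ENNReal.ofReal (α * (α - 1) * s ^ (α - 2)) *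
      ENNReal.ofReal (t - s) = 0 := by
    rw [setLIntegral_congr_fun (g := fun _ => 0) measurableSet_Ioi, lintegral_zero]
    intro s hs
    simp only
    rw [ENNReal.ofReal_of_nonpos (sub_nonpos.2 (Set.mem_Ioi.1 hs).le), mul_zero]
  have hmain : ∀ s ∈ Set.Ioc (0 : ℝ) t, α * (α - 1) * s ^ (α - 2) * (t - s) =
      α * (α - 1) * t * s ^ (α - 2) - α * (α - 1) * s ^ (α - 1) := by
    intro s hs
    rw [show α - 1 = (α - 2) + 1 by ring, Real.rpow_add_one hs.1.ne']
    ring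
  have hcoef : ∀ s ∈ Set.Ioc (0 : ℝ) t, 0 ≤ α * (α - 1) * s ^ (α - 2) := fun s hs =>
    mul_nonneg (mul_nonneg (by linarith) (by linarith)) (Real.rpow_nonneg hs.1.le _)
  rw [hzero, add_zero, ← hval, intervalIntegral.integral_of_le ht,
    ofReal_integral_eq_lintegral_ofReal ((intervalIntegrable_iff_integrableOn_Ioc_of_le ht).1 hint)]
  · refine setLIntegral_congr_fun measurableSet_Ioc fun s hs => ?_
    rw [← hmain s hs, ENNReal.ofReal_mul (hcoef s hs)]
  · filter_upwards [ae_restrict_mem measurableSet_Ioc] with s hs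
    rw [Pi.zero_apply, ← hmain s hs]
    exact mul_nonneg (hcoef s hs) (sub_nonneg.2 hs.2)

/-- For `α < 1` the weight `s ^ (α - 2)` is not integrable at `0` against `(t - s)⁺`. Replacing this
by `t - (t - s)⁺ = min t s` gives convergence at both ends. -/
theorem ofReal_rpow_eq_lintegral_min {α t : ℝ} (hα0 : 0 < α) (hα : α < 1) (ht : 0 ≤ t) :
    ENNReal.ofReal (t ^ α) =
      ∫⁻ s in Set.Ioi (0 : ℝ), ENNReal.ofReal (α * (1 - α) * s ^ (α - 2)) *
        ENNReal.ofReal (min t s) := by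
  rcases ht.eq_or_lt with rfl | ht'
  · rw [Real.zero_rpow hα0.ne', setLIntegral_congr_fun (g := fun _ => 0) measurableSet_Ioi,
      lintegral_zero, ENNReal.ofReal_zero]
    intro s hs
    simp only
    rw [min_eq_left (Set.mem_Ioi.1 hs).le, ENNReal.ofReal_zero, mul_zero]
  have hsplit : Set.Ioi (0 : ℝ) = Set.Ioc 0 t ∪ Set.Ioi t := (Set.Ioc_union_Ioi_eq_Ioi ht).symm
  have hα1 : 0 < 1 - α := by linarith
  have hsmall : ∫⁻ s in Set.Ioc 0 t, ENNReal.ofReal (α * (1 - α) * s ^ (α - 2)) *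
      ENNReal.ofReal (min t s) = ENNReal.ofReal ((1 - α) * t ^ α) := by
    have hval : ∫ s in (0 : ℝ)..t, α * (1 - α) * s ^ (α - 1) = (1 - α) * t ^ α := by
      rw [intervalIntegral.integral_const_mul, integral_rpow (Or.inl (by linarith)),
        show α - 1 + 1 = α by ring, Real.zero_rpow hα0.ne']
      field_simp
      ring
    rw [← hval, intervalIntegral.integral_of_le ht, ofReal_integral_eq_lintegral_ofReal
      ((intervalIntegrable_iff_integrableOn_Ioc_of_le ht).1
        ((intervalIntegral.intervalIntegrable_rpow' (by linarith)).const_mul _))]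
    · refine setLIntegral_congr_fun measurableSet_Ioc fun s hs => ?_
      have h0 : 0 < s := hs.1
      rw [min_eq_right hs.2, ← ENNReal.ofReal_mul (by positivity),
        show α - 1 = (α - 2) + 1 by ring, Real.rpow_add_one h0.ne']
      congr 1
      ring
    · filter_upwards [ae_restrict_mem measurableSet_Ioc] with s hs
      have h0 : 0 < s := hs.1
      rw [Pi.zero_apply]
      positivity
  have hlarge : ∫⁻ s in Set.Ioi t, ENNReal.ofReal (α * (1 - α) * s ^ (α - 2)) *
      ENNReal.ofReal (min t s) = ENNReal.ofReal (α * t ^ α) := by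
    have hval : ∫ s in Set.Ioi t, α * (1 - α) * t * s ^ (α - 2) = α * t ^ α := by
      rw [integral_const_mul, integral_Ioi_rpow_of_lt (by linarith) ht',
        show α - 2 + 1 = α - 1 by ring]
      have h1 : t * t ^ (α - 1) = t ^ α := by
        rw [← Real.rpow_one_add' ht (by linarith)]
        congr 1
        ring
      have h2 : α - 1 ≠ 0 := by linarith
      calc α * (1 - α) * t * (-t ^ (α - 1) / (α - 1))
          = α * (t * t ^ (α - 1)) * ((α - 1) / (α - 1)) := by ring
        _ = α * t ^ α := by rw [h1, div_self h2, mul_one]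
    rw [← hval, ofReal_integral_eq_lintegral_ofReal
      ((integrableOn_Ioi_rpow_of_lt (by linarith) ht').const_mul _)]
    · refine setLIntegral_congr_fun measurableSet_Ioi fun s hs => ?_
      have h0 : 0 < s := ht'.trans hs
      rw [min_eq_left (Set.mem_Ioi.1 hs).le, ← ENNReal.ofReal_mul (by positivity)]
      congr 1
      ring
    · filter_upwards [ae_restrict_mem measurableSet_Ioi] with s hs
      have h0 : 0 < s := ht'.trans hs
      rw [Pi.zero_apply]
      positivity
  rw [hsplit, lintegral_union measurableSet_Ioi
    (Set.disjoint_left.2 fun x hx hx' => not_lt.2 hx.2 hx'), hsmall, hlarge,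
    ← ENNReal.ofReal_add (by positivity) (by positivity)]
  congr 1
  ring

/-- `min t s - t * s` is the Green function of `-d²/dt²` on `[0, 1]` with zero boundary values; `-t
log t` vanishes at both ends and has second derivative `-1/t`. -/
theorem ofReal_negMulLog_eq_lintegral {t : ℝ} (ht : 0 ≤ t) (ht1 : t ≤ 1) :
    ENNReal.ofReal (Real.negMulLog t) =
      ∫⁻ s in Set.Ioc (0 : ℝ) 1, ENNReal.ofReal s⁻¹ * ENNReal.ofReal (min t s - t * s) := by
  rcases ht.eq_or_lt with rfl | ht'
  · rw [Real.negMulLog_zero, setLIntegral_congr_fun (g := fun _ => 0) measurableSet_Ioc,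
      lintegral_zero, ENNReal.ofReal_zero]
    intro s hs
    simp only
    rw [min_eq_left hs.1.le, zero_mul, sub_zero, ENNReal.ofReal_zero, mul_zero]
  have hsmall : ∫⁻ s in Set.Ioc 0 t, ENNReal.ofReal s⁻¹ * ENNReal.ofReal (min t s - t * s) =
      ENNReal.ofReal ((1 - t) * t) := by
    rw [setLIntegral_congr_fun (g := fun _ => ENNReal.ofReal (1 - t)) measurableSet_Ioc]
    · rw [setLIntegral_const, Real.volume_Ioc, ← ENNReal.ofReal_mul (by linarith), sub_zero]
    · intro s hs
      have h0 : 0 < s := hs.1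
      simp only
      rw [min_eq_right hs.2, ← ENNReal.ofReal_mul (by positivity)]
      congr 1
      field_simp
  have hlarge : ∫⁻ s in Set.Ioc t 1, ENNReal.ofReal s⁻¹ * ENNReal.ofReal (min t s - t * s) =
      ENNReal.ofReal (Real.negMulLog t - (1 - t) * t) := by
    have hii : IntervalIntegrable (fun s : ℝ => s⁻¹) volume t 1 :=
      intervalIntegral.intervalIntegrable_inv (fun s hs => by
        rw [Set.uIcc_of_le ht1] at hs
        linarith [hs.1]) continuousOn_id
    have hint : IntervalIntegrable (fun s : ℝ => t * s⁻¹ - t) volume t 1 :=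
      (hii.const_mul _).sub intervalIntegrable_const
    have hval : ∫ s in t..1, (t * s⁻¹ - t) = Real.negMulLog t - (1 - t) * t := by
      rw [intervalIntegral.integral_sub (hii.const_mul _) intervalIntegrable_const,
        intervalIntegral.integral_const_mul, integral_inv_of_pos ht' one_pos,
        intervalIntegral.integral_const, Real.negMulLog, one_div, Real.log_inv, smul_eq_mul]
      ring
    have hnn : ∀ s ∈ Set.Ioc t 1, s⁻¹ * (t - t * s) = t * s⁻¹ - t := by
      intro s hs
      have h0 : 0 < s := ht'.trans hs.1
      field_simp
    have hpos : ∀ s ∈ Set.Ioc t 1, 0 ≤ s⁻¹ * (t - t * s) := by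
      intro s hs
      have h0 : 0 < s := ht'.trans hs.1
      have : t * s ≤ t * 1 := mul_le_mul_of_nonneg_left hs.2 ht
      exact mul_nonneg (by positivity) (by linarith)
    rw [← hval, intervalIntegral.integral_of_le ht1, ofReal_integral_eq_lintegral_ofReal
      ((intervalIntegrable_iff_integrableOn_Ioc_of_le ht1).1 hint)]
    · refine setLIntegral_congr_fun measurableSet_Ioc fun s hs => ?_
      have h0 : 0 < s := ht'.trans hs.1
      rw [min_eq_left hs.1.le, ← hnn s hs, ENNReal.ofReal_mul (by positivity)]
    · filter_upwards [ae_restrict_mem measurableSet_Ioc] with s hs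
      rw [Pi.zero_apply, ← hnn s hs]
      exact hpos s hs
  have hnonneg : 0 ≤ Real.negMulLog t - (1 - t) * t := by
    have h1 := Real.log_le_sub_one_of_pos ht'
    rw [Real.negMulLog]
    nlinarith
  rw [← Set.Ioc_union_Ioc_eq_Ioc ht ht1, lintegral_union measurableSet_Ioc
    (Set.disjoint_left.2 fun x hx hx' => not_lt.2 hx.2 hx'.1), hsmall, hlarge,
    ← ENNReal.ofReal_add (mul_nonneg (by linarith) ht) hnonneg]
  congr 1
  ring

section Comparison

variable {f g : ℕ+ → ℝ}

theorem tsum_min_add_hinge (hf : ∀ x, 0 ≤ f x) (h1 : HasSum f 1) {s : ℝ} (hs : 0 ≤ s) :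
    ∑' x, ENNReal.ofReal (min (f x) s) + hinge f s = 1 := by
  rw [hinge, ← ENNReal.tsum_add, ← ENNReal.ofReal_one, ← h1.tsum_eq,
    ENNReal.ofReal_tsum_of_nonneg hf h1.summable]
  refine tsum_congr fun x => ?_
  rcases le_total (f x) s with h | h
  · rw [min_eq_left h, ENNReal.ofReal_of_nonpos (sub_nonpos.2 h), add_zero]
  · rw [min_eq_right h, ← ENNReal.ofReal_add hs (sub_nonneg.2 h)]
    congr 1
    ring

/-- The part below `s` and the excess add up to total mass `1`, so the inequality reverses. -/
theorem tsum_min_le_of_hinge_le (hf : ∀ x, 0 ≤ f x) (hg : ∀ x, 0 ≤ g x) (hf1 : HasSum f 1)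
    (hg1 : HasSum g 1) {s : ℝ} (hs : 0 ≤ s) (h : hinge g s ≤ hinge f s) :
    ∑' x, ENNReal.ofReal (min (f x) s) ≤ ∑' x, ENNReal.ofReal (min (g x) s) := by
  have h1 := tsum_min_add_hinge hf hf1 hs
  have h2 := tsum_min_add_hinge hg hg1 hs
  have hfin : hinge g s ≠ ⊤ := by
    intro htop
    rw [htop, add_top] at h2
    exact ENNReal.top_ne_one h2
  refine (ENNReal.add_le_add_iff_right hfin).1 ?_
  rw [h2, ← h1]
  gcongr

theorem tsum_rpow_le_of_hinge_le_of_one_lt (hf : ∀ x, 0 ≤ f x) (hg : ∀ x, 0 ≤ g x)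
    (h : ∀ s, 0 < s → hinge g s ≤ hinge f s) {α : ℝ} (hα : 1 < α) :
    ∑' x, ENNReal.ofReal (g x ^ α) ≤ ∑' x, ENNReal.ofReal (f x ^ α) := by
  have key : ∀ p : ℕ+ → ℝ, (∀ x, 0 ≤ p x) → ∑' x, ENNReal.ofReal (p x ^ α) =
      ∫⁻ s in Set.Ioi (0 : ℝ), ENNReal.ofReal (α * (α - 1) * s ^ (α - 2)) * hinge p s := by
    intro p hp
    simp_rw [fun x => ofReal_rpow_eq_lintegral_hinge hα (hp x)]
    rw [← lintegral_tsum fun x => by fun_prop]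
    simp_rw [ENNReal.tsum_mul_left, hinge]
  rw [key f hf, key g hg]
  exact setLIntegral_mono' measurableSet_Ioi fun s hs => mul_le_mul_right (h s hs) _

theorem tsum_rpow_le_of_hinge_le_of_lt_one (hf : ∀ x, 0 ≤ f x) (hg : ∀ x, 0 ≤ g x)
    (hf1 : HasSum f 1) (hg1 : HasSum g 1)
    (h : ∀ s, 0 < s → hinge g s ≤ hinge f s) {α : ℝ} (hα0 : 0 < α) (hα : α < 1) :
    ∑' x, ENNReal.ofReal (f x ^ α) ≤ ∑' x, ENNReal.ofReal (g x ^ α) := by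
  have key : ∀ p : ℕ+ → ℝ, (∀ x, 0 ≤ p x) → ∑' x, ENNReal.ofReal (p x ^ α) =
      ∫⁻ s in Set.Ioi (0 : ℝ), ENNReal.ofReal (α * (1 - α) * s ^ (α - 2)) *
        ∑' x, ENNReal.ofReal (min (p x) s) := by
    intro p hp
    simp_rw [fun x => ofReal_rpow_eq_lintegral_min hα0 hα (hp x)]
    rw [← lintegral_tsum fun x => by fun_prop]
    simp_rw [ENNReal.tsum_mul_left]
  rw [key f hf, key g hg]
  exact setLIntegral_mono' measurableSet_Ioi fun s hs =>
    mul_le_mul_right (tsum_min_le_of_hinge_le hf hg hf1 hg1 (Set.mem_Ioi.1 hs).le (h s hs)) _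

theorem shannonEntropy_le_of_hinge_le (hf : ∀ x, 0 ≤ f x) (hg : ∀ x, 0 ≤ g x)
    (hf1 : HasSum f 1) (hg1 : HasSum g 1)
    (h : ∀ s, 0 < s → hinge g s ≤ hinge f s) :
    shannonEntropy f ≤ shannonEntropy g := by
  have hle : ∀ p : ℕ+ → ℝ, (∀ x, 0 ≤ p x) → HasSum p 1 → ∀ x, p x ≤ 1 := fun p hp hp1 x =>
    le_hasSum hp1 x fun y _ => hp y
  have key : ∀ p : ℕ+ → ℝ, (∀ x, 0 ≤ p x) → HasSum p 1 → shannonEntropy p =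
      ∫⁻ s in Set.Ioc (0 : ℝ) 1, ENNReal.ofReal s⁻¹ *
        ∑' x, ENNReal.ofReal (min (p x) s - p x * s) := by
    intro p hp hp1
    rw [shannonEntropy]
    simp_rw [fun x => ofReal_negMulLog_eq_lintegral (hp x) (hle p hp hp1 x)]
    rw [← lintegral_tsum fun x => by fun_prop]
    simp_rw [ENNReal.tsum_mul_left]
  -- The linear correction `p x * s` sums to `s` for every probability, so it cancels in the
  -- comparison.
  have hadd : ∀ p : ℕ+ → ℝ, (∀ x, 0 ≤ p x) → HasSum p 1 → ∀ s ∈ Set.Ioc (0 : ℝ) 1,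
      ∑' x, ENNReal.ofReal (min (p x) s - p x * s) + ENNReal.ofReal s =
        ∑' x, ENNReal.ofReal (min (p x) s) := by
    intro p hp hp1 s hs
    have h2 : ENNReal.ofReal s = ∑' x, ENNReal.ofReal (p x * s) := by
      rw [← ENNReal.ofReal_tsum_of_nonneg (fun x => mul_nonneg (hp x) hs.1.le)
        (hp1.summable.mul_right s), (hp1.mul_right s).tsum_eq, one_mul]
    rw [h2, ← ENNReal.tsum_add]
    refine tsum_congr fun x => ?_
    have h3 : p x * s ≤ min (p x) s := le_min (mul_le_of_le_one_right (hp x) hs.2)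
      (mul_le_of_le_one_left hs.1.le (hle p hp hp1 x))
    rw [← ENNReal.ofReal_add (sub_nonneg.2 h3) (mul_nonneg (hp x) hs.1.le), sub_add_cancel]
  rw [key f hf hf1, key g hg hg1]
  refine setLIntegral_mono' measurableSet_Ioc fun s hs => mul_le_mul_right ?_ _
  refine (ENNReal.add_le_add_iff_right (ENNReal.ofReal_ne_top (r := s))).1 ?_
  rw [hadd f hf hf1 s hs, hadd g hg hg1 s hs]
  exact tsum_min_le_of_hinge_le hf hg hf1 hg1 hs.1.le (h s hs.1)

end Comparison

/-! ### Minkowski inequalities for the `ℓ_α`-norm -/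

theorem tsum_Lp_add_le {p : ℝ} (hp : 1 ≤ p) (f g : ℕ+ → ℝ≥0∞) :
    (∑' x, (f x + g x) ^ p) ^ (1 / p) ≤
      (∑' x, f x ^ p) ^ (1 / p) + (∑' x, g x ^ p) ^ (1 / p) := by
  have h := ENNReal.lintegral_Lp_add_le (μ := (Measure.count : Measure ℕ+)) (f := f) (g := g)
    (Measurable.of_discrete).aemeasurable (Measurable.of_discrete).aemeasurable hp
  simpa [lintegral_count] using h

theorem tsum_Lp_sum_le {ι : Type*} {p : ℝ} (hp : 1 ≤ p) (s : Finset ι) (f : ι → ℕ+ → ℝ≥0∞) :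
    (∑' x, (∑ i ∈ s, f i x) ^ p) ^ (1 / p) ≤ ∑ i ∈ s, (∑' x, f i x ^ p) ^ (1 / p) := by
  classical
  have hp0 : 0 < p := by linarith
  induction s using Finset.induction_on with
  | empty => simp [hp0]
  | insert a s ha ih =>
    simp only [Finset.sum_insert ha]
    exact (tsum_Lp_add_le hp _ _).trans (add_le_add_right ih _)

theorem sum_Lp_sum_le {ι κ : Type*} {p : ℝ} (hp : 1 ≤ p) (s : Finset ι) (t : Finset κ)
    (f : ι → κ → ℝ≥0∞) :
    (∑ x ∈ t, (∑ i ∈ s, f i x) ^ p) ^ (1 / p) ≤ ∑ i ∈ s, (∑ x ∈ t, f i x ^ p) ^ (1 / p) := by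
  classical
  have hp0 : 0 < p := by linarith
  induction s using Finset.induction_on with
  | empty => simp [hp0]
  | insert a s ha ih =>
    simp only [Finset.sum_insert ha]
    exact (ENNReal.Lp_add_le t _ _ hp).trans (add_le_add_right ih _)

/-- Reverse Minkowski is Minkowski with exponent `1 / α` for the functions `f ^ α`, the two
summations trading roles. This is done on finite sets of `x`, followed by a limit. -/
theorem sum_le_tsum_Lp_sum {ι κ : Type*} {α : ℝ} (hα0 : 0 < α) (hα : α ≤ 1) (s : Finset ι)
    (f : ι → κ → ℝ≥0∞) :
    ∑ i ∈ s, (∑' x, f i x ^ α) ^ (1 / α) ≤ (∑' x, (∑ i ∈ s, f i x) ^ α) ^ (1 / α) := by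
  have hfin : ∀ t : Finset κ, ∑ i ∈ s, (∑ x ∈ t, f i x ^ α) ^ (1 / α) ≤
      (∑' x, (∑ i ∈ s, f i x) ^ α) ^ (1 / α) := by
    intro t
    have h := sum_Lp_sum_le (p := 1 / α) ((one_le_div hα0).2 hα) t s (fun x i => f i x ^ α)
    have h2 : ∀ i x, (f i x ^ α) ^ (1 / α) = f i x := fun i x => by
      rw [← ENNReal.rpow_mul, mul_one_div_cancel hα0.ne', ENNReal.rpow_one]
    simp only [h2, one_div_one_div] at h
    have h3 := ENNReal.rpow_le_rpow h (one_div_pos.2 hα0).le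
    rw [← ENNReal.rpow_mul, mul_one_div_cancel hα0.ne', ENNReal.rpow_one] at h3
    exact h3.trans (ENNReal.rpow_le_rpow (ENNReal.sum_le_tsum t) (one_div_pos.2 hα0).le)
  have hlim : Filter.Tendsto (fun t : Finset κ => ∑ i ∈ s, (∑ x ∈ t, f i x ^ α) ^ (1 / α))
      Filter.atTop (nhds (∑ i ∈ s, (∑' x, f i x ^ α) ^ (1 / α))) :=
    tendsto_finsetSum s fun i _ =>
      (ENNReal.continuous_rpow_const.tendsto _).comp ENNReal.summable.hasSum
  exact le_of_tendsto' hlim hfin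

/-! ### Mixtures of decreasing rearrangements -/

section Mixture

variable {𝒴 : Type*} [Fintype 𝒴]

/-- `Q` is the mixture of the distributions `p y` with weights `w y`. -/
structure IsMixture (w : 𝒴 → ℝ) (p : 𝒴 → PMF ℕ+) (Q : PMF ℕ+) : Prop where
  nonneg : ∀ y, 0 ≤ w y
  sum_eq_one : ∑ y, w y = 1
  mass_eq : ∀ x, (Q x).toReal = ∑ y, w y * (p y x).toReal

/-- The mixture of the decreasing rearrangements of the distributions `p y`. -/
noncomputable def avgDecr (w : 𝒴 → ℝ) (p : 𝒴 → PMF ℕ+) (i : ℕ) : ℝ := ∑ y, w y * decr (p y) i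

variable {w : 𝒴 → ℝ} {p : 𝒴 → PMF ℕ+} {Q : PMF ℕ+}

theorem IsMixture.avgDecr_nonneg (h : IsMixture w p Q) (i : ℕ) : 0 ≤ avgDecr w p i :=
  Finset.sum_nonneg fun y _ => mul_nonneg (h.nonneg y) (decr_nonneg _ _)

theorem IsMixture.hasSum_avgDecr (h : IsMixture w p Q) :
    HasSum (fun x : ℕ+ => avgDecr w p x) 1 := by
  have h1 := hasSum_sum (s := Finset.univ) fun y (_ : y ∈ Finset.univ) =>
    (hasSum_decr (p y)).mul_left (w y)
  simp only [mul_one, h.sum_eq_one] at h1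
  exact h1

theorem IsMixture.sum_mass (h : IsMixture w p Q) (T : Finset ℕ+) :
    ∑ x ∈ T, (Q x).toReal = ∑ y, w y * ∑ x ∈ T, (p y x).toReal := by
  simp_rw [h.mass_eq, Finset.mul_sum]
  exact Finset.sum_comm

theorem IsMixture.sum_list_le (h : IsMixture w p Q) {k : ℕ} (T : 𝒴 → Finset ℕ+)
    (hT : ∀ y, (T y).card ≤ k) :
    ∑ y, w y * ∑ x ∈ T y, (p y x).toReal ≤ ∑ n ∈ Finset.range k, avgDecr w p (n + 1) := by
  simp_rw [avgDecr]
  rw [Finset.sum_comm]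
  refine Finset.sum_le_sum fun y _ => ?_
  rw [← Finset.mul_sum, ← topSum_eq_sum_range]
  exact mul_le_mul_of_nonneg_left (sum_le_topSum (p y) (T y) (hT y)) (h.nonneg y)

/-- The `k` heaviest symbols of `Q` serve as a list not depending on `y`. -/
theorem IsMixture.topSum_le (h : IsMixture w p Q) (k : ℕ) :
    topSum Q k ≤ ∑ n ∈ Finset.range k, avgDecr w p (n + 1) := by
  obtain ⟨T, hT, hsum⟩ := exists_card_eq_topSum Q k
  rw [← hsum, h.sum_mass]
  exact h.sum_list_le (fun _ => T) fun _ => hT.le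

/-- A list decoder with lists of length `L` yields, for lists of length `L + j`, the gain of `j`
symbols outside the union of all lists. -/
theorem IsMixture.list_add_topSum_le (h : IsMixture w p Q) {L : ℕ} (f : 𝒴 → Finset ℕ+)
    (hf : ∀ y, (f y).card ≤ L) (j : ℕ) :
    ∑ y, w y * ∑ x ∈ f y, (p y x).toReal +
        (topSum Q (Fintype.card 𝒴 * L + j) - topSum Q (Fintype.card 𝒴 * L)) ≤
      ∑ n ∈ Finset.range (L + j), avgDecr w p (n + 1) := by
  classical
  -- The union of the lists has at most `|𝒴| L` symbols. As `B` is the same for all `y`, its mixed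
  -- weight is its `Q`-mass.
  obtain ⟨B, hB, hdisj, hsum⟩ := exists_disjoint_topSum Q (Finset.univ.biUnion f)
    (n := Fintype.card 𝒴 * L) (by
      simpa using Finset.card_biUnion_le_card_mul Finset.univ f L fun y _ => hf y) j
  have hd : ∀ y, Disjoint (f y) B := fun y =>
    Finset.disjoint_of_subset_left (Finset.subset_biUnion_of_mem f (Finset.mem_univ y)) hdisj
  have h1 := h.sum_list_le (k := L + j) (fun y => f y ∪ B) fun y => by
    have := hf y
    rw [Finset.card_union_of_disjoint (hd y)]
    omega
  refine le_trans ?_ h1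
  simp_rw [fun y => Finset.sum_union (f := fun x => (p y x).toReal) (hd y), mul_add, Finset.sum_add_distrib]
  rw [← h.sum_mass]
  linarith

theorem IsMixture.hinge_fanoType2_le (h : IsMixture w p Q) {L : ℕ} {ε : ℝ} (hL : 1 ≤ L)
    (hsys : Admissible Q L ε (Fintype.card 𝒴))
    (herr : ∀ δ > 0, ∃ f : 𝒴 → Finset ℕ+, (∀ y, (f y).card ≤ L) ∧
      1 - ε - δ ≤ ∑ y, w y * ∑ x ∈ f y, (p y x).toReal) {s : ℝ} (hs : 0 < s) :
    hinge (fanoType2 Q L ε (Fintype.card 𝒴)) s ≤ hinge (fun x : ℕ+ => avgDecr w p x) s := by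
  refine FanoRenyi.hinge_fanoType2_le hL hsys (avgDecr w p) h.topSum_le (fun j => ?_) hs
  refine le_of_forall_pos_le_add fun δ hδ => ?_
  obtain ⟨f, hf, hle⟩ := herr δ hδ
  have := h.list_add_topSum_le f hf j
  linarith

/-- Jensen at each rank. Nonnegativity on `[0, 1]` keeps `ENNReal.ofReal` from truncating the
averaged terms. -/
theorem IsMixture.sum_concave_le (h : IsMixture w p Q) {G : ℝ → ℝ}
    (hG : ConcaveOn ℝ (Set.Ici 0) G) (hG0 : ∀ t, 0 ≤ t → t ≤ 1 → 0 ≤ G t) :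
    ∑ y, ENNReal.ofReal (w y) * ∑' x : ℕ+, ENNReal.ofReal (G (decr (p y) x)) ≤
      ∑' x : ℕ+, ENNReal.ofReal (G (avgDecr w p x)) := by
  simp_rw [← ENNReal.tsum_mul_left]
  rw [← Summable.tsum_finsetSum fun _ _ => ENNReal.summable]
  refine ENNReal.tsum_le_tsum fun x => ?_
  simp_rw [fun y => (ENNReal.ofReal_mul (q := G (decr (p y) x)) (h.nonneg y)).symm]
  rw [← ENNReal.ofReal_sum_of_nonneg fun y _ => mul_nonneg (h.nonneg y)
    (hG0 _ (decr_nonneg _ _) (le_hasSum (hasSum_decr (p y)) x fun _ _ => decr_nonneg _ _))]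
  refine ENNReal.ofReal_le_ofReal ?_
  simpa [avgDecr] using hG.le_map_sum (fun y _ => h.nonneg y) h.sum_eq_one
    fun y _ => Set.mem_Ici.2 (decr_nonneg (p y) x)

theorem IsMixture.le_sum_convex (h : IsMixture w p Q) {G : ℝ → ℝ}
    (hG : ConvexOn ℝ (Set.Ici 0) G) (hG0 : ∀ t, 0 ≤ t → 0 ≤ G t) :
    ∑' x : ℕ+, ENNReal.ofReal (G (avgDecr w p x)) ≤
      ∑ y, ENNReal.ofReal (w y) * ∑' x : ℕ+, ENNReal.ofReal (G (decr (p y) x)) := by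
  simp_rw [← ENNReal.tsum_mul_left]
  rw [← Summable.tsum_finsetSum fun _ _ => ENNReal.summable]
  refine ENNReal.tsum_le_tsum fun x => ?_
  simp_rw [fun y => (ENNReal.ofReal_mul (q := G (decr (p y) x)) (h.nonneg y)).symm]
  rw [← ENNReal.ofReal_sum_of_nonneg fun y _ => mul_nonneg (h.nonneg y)
    (hG0 _ (decr_nonneg _ _))]
  refine ENNReal.ofReal_le_ofReal ?_
  simpa [avgDecr] using hG.map_sum_le (fun y _ => h.nonneg y) h.sum_eq_one
    fun y _ => Set.mem_Ici.2 (decr_nonneg (p y) x)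

theorem lNorm_const_mul {α : ℝ} (hα : 0 < α) {c : ℝ} (hc : 0 ≤ c) (P : ℕ+ → ℝ) :
    (∑' x, ENNReal.ofReal (c * P x) ^ α) ^ (1 / α) = ENNReal.ofReal c * lNorm α P := by
  simp_rw [fun x => ENNReal.ofReal_mul (q := P x) hc, fun x =>
    ENNReal.mul_rpow_of_nonneg (ENNReal.ofReal c) (ENNReal.ofReal (P x)) hα.le,
    ENNReal.tsum_mul_left]
  rw [ENNReal.mul_rpow_of_nonneg _ _ (one_div_pos.2 hα).le, ← ENNReal.rpow_mul,
    mul_one_div_cancel hα.ne', ENNReal.rpow_one, lNorm]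

theorem IsMixture.ofReal_avgDecr (h : IsMixture w p Q) (i : ℕ) :
    ENNReal.ofReal (avgDecr w p i) = ∑ y, ENNReal.ofReal (w y * decr (p y) i) :=
  ENNReal.ofReal_sum_of_nonneg fun y _ => mul_nonneg (h.nonneg y) (decr_nonneg _ _)

theorem IsMixture.lNorm_avgDecr_le (h : IsMixture w p Q) {α : ℝ} (hα : 1 ≤ α) :
    lNorm α (fun x => avgDecr w p x) ≤
      ∑ y, ENNReal.ofReal (w y) * lNorm α (fun x => decr (p y) x) := by
  simp_rw [fun y => (lNorm_const_mul (by linarith) (h.nonneg y) (fun x => decr (p y) x)).symm,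
    lNorm, h.ofReal_avgDecr]
  exact tsum_Lp_sum_le hα _ _

theorem IsMixture.le_lNorm_avgDecr (h : IsMixture w p Q) {α : ℝ} (hα0 : 0 < α) (hα : α ≤ 1) :
    ∑ y, ENNReal.ofReal (w y) * lNorm α (fun x => decr (p y) x) ≤
      lNorm α (fun x => avgDecr w p x) := by
  simp_rw [fun y => (lNorm_const_mul hα0 (h.nonneg y) (fun x => decr (p y) x)).symm,
    lNorm, h.ofReal_avgDecr]
  exact sum_le_tsum_Lp_sum hα0 hα _ _

end Mixture

/-! ### The mixture given by a pair of random variables -/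

section Law

variable {Ω 𝒴 : Type*} [MeasurableSpace Ω] [MeasurableSpace 𝒴]

/-- The conditional distribution of `X` given `Y = y`. -/
noncomputable def condPMF (μ : Measure Ω) [IsProbabilityMeasure μ] (X : Ω → ℕ+) (Y : Ω → 𝒴)
    (y : 𝒴) : PMF ℕ+ :=
  (condDistrib X Y μ y).toPMF

variable {μ : Measure Ω} [IsProbabilityMeasure μ] {X : Ω → ℕ+} {Y : Ω → 𝒴}

theorem toReal_condPMF (y : 𝒴) (x : ℕ+) :
    (condPMF μ X Y y x).toReal = (condDistrib X Y μ y).real {x} := by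
  rw [condPMF, Measure.toPMF_apply, Measure.real]

theorem condLaw_eq (ω : Ω) :
    condLaw μ X Y ω = fun x => (condPMF μ X Y (Y ω) x).toReal := by
  funext x
  rw [condLaw, toReal_condPMF]

theorem tsum_rpow_condLaw {α : ℝ} (hα : 0 < α) (ω : Ω) :
    ∑' x, ENNReal.ofReal (condLaw μ X Y ω x) ^ α =
      ∑' x : ℕ+, ENNReal.ofReal (decr (condPMF μ X Y (Y ω)) x) ^ α := by
  rw [tsum_comp_decr _ (fun t => ENNReal.ofReal t ^ α) (by simp [hα]), condLaw_eq]

variable [Fintype 𝒴] [DiscreteMeasurableSpace 𝒴]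

theorem lintegral_comp_eq_sum (hY : Measurable Y) (F : 𝒴 → ℝ≥0∞) :
    ∫⁻ ω, F (Y ω) ∂μ = ∑ y, ENNReal.ofReal ((μ.map Y).real {y}) * F y := by
  have := Measure.isProbabilityMeasure_map (μ := μ) hY.aemeasurable
  rw [← lintegral_map (f := F) Measurable.of_discrete hY, lintegral_fintype]
  refine Finset.sum_congr rfl fun y _ => ?_
  rw [mul_comm, Measure.real, ENNReal.ofReal_toReal (measure_ne_top _ _)]

/-- Disintegration of the law of `(Y, X)`. Constant one-element lists give the mixture identity for
`Q`; general lists give the success probability of a decoder. -/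
theorem measureReal_mem_list (hX : Measurable X) (hY : Measurable Y) (f : 𝒴 → Finset ℕ+) :
    μ.real {ω | X ω ∈ f (Y ω)} =
      ∑ y, (μ.map Y).real {y} * ∑ x ∈ f y, (condPMF μ X Y y x).toReal := by
  have := Measure.isProbabilityMeasure_map (μ := μ) hY.aemeasurable
  have hS : MeasurableSet {z : 𝒴 × ℕ+ | z.2 ∈ f z.1} := MeasurableSet.of_discrete
  have h1 : μ {ω | X ω ∈ f (Y ω)} =
      ∑ y, condDistrib X Y μ y (f y) * (μ.map Y) {y} := by
    have h2 : μ {ω | X ω ∈ f (Y ω)} =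
        (μ.map fun ω => (Y ω, X ω)) {z : 𝒴 × ℕ+ | z.2 ∈ f z.1} := by
      rw [Measure.map_apply (hY.prodMk hX) hS]
      rfl
    rw [h2, ← compProd_map_condDistrib hX.aemeasurable, Measure.compProd_apply hS,
      lintegral_fintype]
    rfl
  rw [Measure.real, h1, ENNReal.toReal_sum fun y _ =>
    ENNReal.mul_ne_top (measure_ne_top _ _) (measure_ne_top _ _)]
  refine Finset.sum_congr rfl fun y _ => ?_
  rw [ENNReal.toReal_mul, mul_comm]
  congr 1
  simp_rw [toReal_condPMF]
  exact (sum_measureReal_singleton (μ := condDistrib X Y μ y) (f y)).symm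

variable {Q : PMF ℕ+} {L : ℕ} {ε : ℝ}

theorem Feasible.isMixture (h : Feasible Q L ε μ X Y) :
    IsMixture (fun y => (μ.map Y).real {y}) (condPMF μ X Y) Q where
  nonneg _ := measureReal_nonneg
  sum_eq_one := by
    have := Measure.isProbabilityMeasure_map (μ := μ) h.measurable_Y.aemeasurable
    rw [sum_measureReal_singleton (μ := μ.map Y) Finset.univ, Finset.coe_univ, probReal_univ]
  mass_eq x := by
    have h1 := measureReal_mem_list (μ := μ) h.measurable_X h.measurable_Y fun _ => {x}
    simp only [Finset.mem_singleton, Finset.sum_singleton] at h1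
    rw [← h1, Measure.real]
    congr 1
    have h2 : μ {ω | X ω = x} = μ.map X {x} := by
      rw [Measure.map_apply h.measurable_X (measurableSet_singleton x)]
      rfl
    rw [h2, h.law_X, Q.toMeasure_apply_singleton x (measurableSet_singleton x)]

theorem Feasible.exists_list (h : Feasible Q L ε μ X Y) (hL : 1 ≤ L) {δ : ℝ} (hδ : 0 < δ) :
    ∃ f : 𝒴 → Finset ℕ+, (∀ y, (f y).card ≤ L) ∧
      1 - ε - δ ≤ ∑ y, (μ.map Y).real {y} * ∑ x ∈ f y, (condPMF μ X Y y x).toReal := by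
  have hne : Nonempty {f : 𝒴 → Finset ℕ+ // ∀ y, 1 ≤ (f y).card ∧ (f y).card ≤ L} :=
    ⟨⟨fun _ => {1}, fun _ => by simp [hL]⟩⟩
  have hlt : listError L μ X Y < ε + δ := h.error_le.trans_lt (by linarith)
  -- The error is an infimum over infinitely many decoders; a decoder within `δ` suffices, with no
  -- need for attainment.
  obtain ⟨⟨f, hf⟩, hlt⟩ := exists_lt_of_ciInf_lt hlt
  refine ⟨f, fun y => (hf y).2, ?_⟩
  rw [← measureReal_mem_list h.measurable_X h.measurable_Y]
  have hmeas : MeasurableSet {ω | X ω ∈ f (Y ω)} :=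
    (h.measurable_Y.prodMk h.measurable_X)
      (MeasurableSet.of_discrete (s := {z : 𝒴 × ℕ+ | z.2 ∈ f z.1}))
  have h1 := probReal_compl_eq_one_sub (μ := μ) hmeas
  have h2 : {ω | X ω ∈ f (Y ω)}ᶜ = {ω | X ω ∉ f (Y ω)} := rfl
  rw [h2] at h1
  dsimp only at hlt
  linarith

theorem Feasible.hinge_le (h : Feasible Q L ε μ X Y) (hL : 1 ≤ L)
    (hsys : Admissible Q L ε (Fintype.card 𝒴)) {s : ℝ} (hs : 0 < s) :
    hinge (fanoType2 Q L ε (Fintype.card 𝒴)) s ≤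
      hinge (fun x : ℕ+ => avgDecr (fun y => (μ.map Y).real {y}) (condPMF μ X Y) x) s :=
  h.isMixture.hinge_fanoType2_le hL hsys (fun _ hδ => h.exists_list hL hδ) hs

theorem condShannon_eq (hY : Measurable Y) :
    condShannon μ X Y = ∑ y, ENNReal.ofReal ((μ.map Y).real {y}) *
      ∑' x : ℕ+, ENNReal.ofReal (Real.negMulLog (decr (condPMF μ X Y y) x)) := by
  rw [condShannon, ← lintegral_comp_eq_sum hY]
  refine lintegral_congr fun ω => ?_
  rw [tsum_comp_decr _ (fun t => ENNReal.ofReal (Real.negMulLog t)) (by simp), shannonEntropy,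
    condLaw_eq]

theorem lintegral_lNorm_eq (hY : Measurable Y) {α : ℝ} (hα : 0 < α) :
    ∫⁻ ω, lNorm α (condLaw μ X Y ω) ∂μ = ∑ y, ENNReal.ofReal ((μ.map Y).real {y}) *
      lNorm α (fun x : ℕ+ => decr (condPMF μ X Y y) x) := by
  rw [← lintegral_comp_eq_sum hY]
  refine lintegral_congr fun ω => ?_
  rw [lNorm, lNorm, tsum_rpow_condLaw hα]

theorem lintegral_lNorm_rpow_eq (hY : Measurable Y) {α : ℝ} (hα : 0 < α) :
    ∫⁻ ω, lNorm α (condLaw μ X Y ω) ^ α ∂μ = ∑ y, ENNReal.ofReal ((μ.map Y).real {y}) *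
      ∑' x : ℕ+, ENNReal.ofReal (decr (condPMF μ X Y y) x ^ α) := by
  rw [← lintegral_comp_eq_sum hY]
  refine lintegral_congr fun ω => ?_
  rw [lNorm, ← ENNReal.rpow_mul, one_div_mul_cancel hα.ne', ENNReal.rpow_one,
    tsum_rpow_condLaw hα]
  exact tsum_congr fun x => ENNReal.ofReal_rpow_of_nonneg (decr_nonneg _ _) hα.le

/-! ### The upper bounds for a single pair -/

theorem Feasible.condShannon_le (h : Feasible Q L ε μ X Y) (hL : 1 ≤ L)
    (hsys : Admissible Q L ε (Fintype.card 𝒴)) :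
    condShannon μ X Y ≤ shannonEntropy (fanoType2 Q L ε (Fintype.card 𝒴)) := by
  rw [condShannon_eq h.measurable_Y]
  refine (h.isMixture.sum_concave_le Real.concaveOn_negMulLog
    fun t => Real.negMulLog_nonneg).trans ?_
  exact shannonEntropy_le_of_hinge_le (fun x => h.isMixture.avgDecr_nonneg x)
    (fanoType2_nonneg hL hsys) h.isMixture.hasSum_avgDecr (hasSum_fanoType2 hL hsys)
    fun s hs => h.hinge_le hL hsys hs

theorem mul_log_le_mul_log_of_nonneg {c : ℝ} (hc : 0 ≤ c) {a b : ℝ≥0∞} (h : a ≤ b) :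
    (c : EReal) * ENNReal.log a ≤ (c : EReal) * ENNReal.log b :=
  mul_le_mul_of_nonneg_left (ENNReal.log_le_log h) (by exact_mod_cast hc)

/-- For `α > 1` the prefactors `α / (1 - α)` and `1 / (1 - α)` are negative, so power sums are
compared in the opposite direction. -/
theorem mul_log_le_mul_log_of_nonpos {c : ℝ} (hc : c ≤ 0) {a b : ℝ≥0∞} (h : b ≤ a) :
    (c : EReal) * ENNReal.log a ≤ (c : EReal) * ENNReal.log b := by
  have h1 := mul_log_le_mul_log_of_nonneg (neg_nonneg.2 hc) h
  rwa [EReal.coe_neg, neg_mul, neg_mul, EReal.neg_le_neg_iff] at h1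

theorem renyiEntropy_eq_log_lNorm {α : ℝ} (hα : 0 < α) (hα1 : α ≠ 1) (P : ℕ+ → ℝ) :
    renyiEntropy α P = ((α / (1 - α) : ℝ) : EReal) * ENNReal.log (lNorm α P) := by
  rw [renyiEntropy, if_neg hα1, lNorm, ENNReal.log_rpow, ← mul_assoc, ← EReal.coe_mul]
  congr 3
  field_simp

theorem Feasible.tsum_rpow_fanoType2_le (h : Feasible Q L ε μ X Y) (hL : 1 ≤ L)
    (hsys : Admissible Q L ε (Fintype.card 𝒴)) {α : ℝ} (hα : 1 < α) :
    ∑' x, ENNReal.ofReal (fanoType2 Q L ε (Fintype.card 𝒴) x ^ α) ≤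
      ∑' x : ℕ+, ENNReal.ofReal
        (avgDecr (fun y => (μ.map Y).real {y}) (condPMF μ X Y) x ^ α) :=
  tsum_rpow_le_of_hinge_le_of_one_lt (fun x => h.isMixture.avgDecr_nonneg x)
    (fanoType2_nonneg hL hsys) (fun _ hs => h.hinge_le hL hsys hs) hα

theorem Feasible.tsum_rpow_avgDecr_le (h : Feasible Q L ε μ X Y) (hL : 1 ≤ L)
    (hsys : Admissible Q L ε (Fintype.card 𝒴)) {α : ℝ} (hα0 : 0 < α) (hα : α < 1) :
    ∑' x : ℕ+, ENNReal.ofReal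
        (avgDecr (fun y => (μ.map Y).real {y}) (condPMF μ X Y) x ^ α) ≤
      ∑' x, ENNReal.ofReal (fanoType2 Q L ε (Fintype.card 𝒴) x ^ α) :=
  tsum_rpow_le_of_hinge_le_of_lt_one (fun x => h.isMixture.avgDecr_nonneg x)
    (fanoType2_nonneg hL hsys) h.isMixture.hasSum_avgDecr (hasSum_fanoType2 hL hsys)
    (fun _ hs => h.hinge_le hL hsys hs) hα0 hα

theorem tsum_ofReal_rpow {α : ℝ} (hα : 0 < α) {P : ℕ+ → ℝ} (hP : ∀ x, 0 ≤ P x) :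
    ∑' x, ENNReal.ofReal (P x) ^ α = ∑' x, ENNReal.ofReal (P x ^ α) :=
  tsum_congr fun x => ENNReal.ofReal_rpow_of_nonneg (hP x) hα.le

theorem lNorm_le_lNorm {α : ℝ} (hα : 0 < α) {P R : ℕ+ → ℝ} (hP : ∀ x, 0 ≤ P x)
    (hR : ∀ x, 0 ≤ R x)
    (h : ∑' x, ENNReal.ofReal (P x ^ α) ≤ ∑' x, ENNReal.ofReal (R x ^ α)) :
    lNorm α P ≤ lNorm α R := by
  rw [lNorm, lNorm, tsum_ofReal_rpow hα hP, tsum_ofReal_rpow hα hR]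
  exact ENNReal.rpow_le_rpow h (one_div_pos.2 hα).le

theorem Feasible.arimoto_le (h : Feasible Q L ε μ X Y) (hL : 1 ≤ L)
    (hsys : Admissible Q L ε (Fintype.card 𝒴)) {α : ℝ} (hα : 0 < α) :
    arimoto α μ X Y ≤ renyiEntropy α (fanoType2 Q L ε (Fintype.card 𝒴)) := by
  by_cases hα1 : α = 1
  · rw [arimoto, renyiEntropy, if_pos hα1, if_pos hα1, EReal.coe_ennreal_le_coe_ennreal_iff]
    exact h.condShannon_le hL hsys
  rw [arimoto, if_neg hα1, renyiEntropy_eq_log_lNorm hα hα1, lintegral_lNorm_eq h.measurable_Y hα]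
  rcases lt_or_gt_of_ne hα1 with hlt | hgt
  · refine mul_log_le_mul_log_of_nonneg (div_nonneg hα.le (by linarith)) ?_
    refine (h.isMixture.le_lNorm_avgDecr hα hlt.le).trans ?_
    exact lNorm_le_lNorm hα (fun x => h.isMixture.avgDecr_nonneg x) (fanoType2_nonneg hL hsys)
      (h.tsum_rpow_avgDecr_le hL hsys hα hlt)
  · refine mul_log_le_mul_log_of_nonpos (div_nonpos_of_nonneg_of_nonpos hα.le (by linarith)) ?_
    refine le_trans ?_ (h.isMixture.lNorm_avgDecr_le hgt.le)
    exact lNorm_le_lNorm hα (fanoType2_nonneg hL hsys) (fun x => h.isMixture.avgDecr_nonneg x)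
      (h.tsum_rpow_fanoType2_le hL hsys hgt)

theorem Feasible.hayashi_le (h : Feasible Q L ε μ X Y) (hL : 1 ≤ L)
    (hsys : Admissible Q L ε (Fintype.card 𝒴)) {α : ℝ} (hα : 0 < α) :
    hayashi α μ X Y ≤ renyiEntropy α (fanoType2 Q L ε (Fintype.card 𝒴)) := by
  by_cases hα1 : α = 1
  · rw [hayashi, renyiEntropy, if_pos hα1, if_pos hα1, EReal.coe_ennreal_le_coe_ennreal_iff]
    exact h.condShannon_le hL hsys
  rw [hayashi, renyiEntropy, if_neg hα1, if_neg hα1, lintegral_lNorm_rpow_eq h.measurable_Y hα,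
    tsum_ofReal_rpow hα (fanoType2_nonneg hL hsys)]
  rcases lt_or_gt_of_ne hα1 with hlt | hgt
  · refine mul_log_le_mul_log_of_nonneg (div_nonneg zero_le_one (by linarith)) ?_
    refine (h.isMixture.sum_concave_le (G := fun t => t ^ α)
      (Real.concaveOn_rpow hα.le hlt.le) fun t ht _ => Real.rpow_nonneg ht α).trans ?_
    exact h.tsum_rpow_avgDecr_le hL hsys hα hlt
  · refine mul_log_le_mul_log_of_nonpos
      (div_nonpos_of_nonneg_of_nonpos zero_le_one (by linarith)) ?_
    refine le_trans ?_ (h.isMixture.le_sum_convex (G := fun t => t ^ α)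
      (convexOn_rpow hgt.le) fun t ht => Real.rpow_nonneg ht α)
    exact h.tsum_rpow_fanoType2_le hL hsys hgt

end Law

/-! ### The explicit value of the entropy of the Fano-distribution of type 2 -/

section Value

variable {Q : PMF ℕ+} {L : ℕ} {ε : ℝ} {m : ℕ}

theorem tsum_subtype_eq_tsum_ite (p : ℕ+ → Prop) [DecidablePred p] (f : ℕ+ → ℝ≥0∞) :
    ∑' x : {x : ℕ+ // p x}, f x.1 = ∑' x, if p x then f x else 0 := by
  rw [← Subtype.val_injective.tsum_eq (g := fun x : {x : ℕ+ // p x} => x.1)]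
  · exact tsum_congr fun x => (if_pos x.2).symm
  · intro x hx
    by_contra hcon
    exact hx (if_neg fun hp => hcon ⟨⟨x, hp⟩, rfl⟩)

theorem tsum_fanoType2 (hL : 1 ≤ L) (hsys : Admissible Q L ε m) (G : ℝ → ℝ)
    (hG : ∀ t, 0 ≤ t → t ≤ 1 → 0 ≤ G t) :
    ∑' x, ENNReal.ofReal (G (fanoType2 Q L ε m x)) =
      ENNReal.ofReal (((L : ℝ) - (J Q L ε : ℝ) + 1) * G (V Q L ε (J Q L ε))
        + ((K₂ Q L ε m : ℝ) - (L : ℝ)) * G (W Q L ε (K₂ Q L ε m)))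
      + ∑' x : {x : ℕ+ // (x : ℕ) < J Q L ε ∨ K₂ Q L ε m < (x : ℕ)},
          ENNReal.ofReal (G (decr Q x.1)) := by
  have hle : topSum Q L ≤ 1 - ε := by linarith [hsys.2]
  have hP1 : ∀ x, fanoType2 Q L ε m x ≤ 1 := fun x =>
    le_hasSum (hasSum_fanoType2 hL hsys) x fun y _ => fanoType2_nonneg hL hsys y
  let b : ℕ → ℝ≥0∞ := fun n => if n < J Q L ε ∨ K₂ Q L ε m < n then 0
    else ENNReal.ofReal (G (fanoNat Q L ε m n))
  have hsplit : ∀ x : ℕ+, ENNReal.ofReal (G (fanoType2 Q L ε m x)) =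
      b x + if (x : ℕ) < J Q L ε ∨ K₂ Q L ε m < (x : ℕ) then
        ENNReal.ofReal (G (decr Q x)) else 0 := by
    intro x
    by_cases hx : (x : ℕ) < J Q L ε ∨ K₂ Q L ε m < (x : ℕ)
    · simp [b, fanoType2, hx]
    · simp [b, fanoType2_eq_fanoNat, hx]
  rw [tsum_subtype_eq_tsum_ite _ fun x : ℕ+ => ENNReal.ofReal (G (decr Q x)),
    tsum_congr hsplit, ENNReal.tsum_add, tsum_pnat_eq_tsum_succ (f := b)]
  congr 1
  rcases hle.eq_or_lt with heq | hlt
  -- Here `J = L + 1` and `K₂ = L`: both coefficients vanish, so the conventional values `1` and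
  -- `-1` of `V` and `W` are harmless.
  · obtain ⟨hJ, hK⟩ := J_K₂_of_topSum_eq (ε := ε) hL (hsys.one_le hL) heq
    have hb : ∀ n, b (n + 1) = 0 := fun n => if_pos (by omega)
    simp [hb, hJ, hK]
  · have h := hsys.plateaus hL hlt
    have h1 := h.one_le_J
    have h2 := h.J_le
    have h3 := h.lt_K₂
    -- The upper plateau value is the probability of place `L`, hence lies in the range where `G` is
    -- nonnegative.
    have hV1 : V Q L ε (J Q L ε) ≤ 1 := by
      obtain ⟨x, hx⟩ : ∃ x : ℕ+, (x : ℕ) = L := ⟨⟨L, hL⟩, rfl⟩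
      have := hP1 x
      rw [fanoType2_eq_fanoNat, hx, fanoNat] at this
      rwa [if_neg (by omega), if_pos le_rfl] at this
    have hGV : 0 ≤ G (V Q L ε (J Q L ε)) := hG _ h.V_pos.le hV1
    have hGW : 0 ≤ G (W Q L ε (K₂ Q L ε m)) := hG _ h.W_nonneg (h.W_le_V.trans hV1)
    rw [tsum_eq_sum (s := Finset.Ico (J Q L ε - 1) (K₂ Q L ε m)) fun n hn => if_pos (by
        simp only [Finset.mem_Ico, not_and] at hn
        omega),
      ← Finset.sum_Ico_consecutive _ (show J Q L ε - 1 ≤ L by omega) h3.le,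
      Finset.sum_congr (g := fun _ => ENNReal.ofReal (G (V Q L ε (J Q L ε)))) rfl,
      Finset.sum_congr (s₁ := Finset.Ico L _)
        (g := fun _ => ENNReal.ofReal (G (W Q L ε (K₂ Q L ε m)))) rfl,
      Finset.sum_const, Finset.sum_const, Nat.card_Ico, Nat.card_Ico, ← ENNReal.ofReal_nsmul,
      ← ENNReal.ofReal_nsmul, ← ENNReal.ofReal_add (nsmul_nonneg hGV _) (nsmul_nonneg hGW _),
      nsmul_eq_mul, nsmul_eq_mul, Nat.cast_sub (by omega), Nat.cast_sub h1,
      Nat.cast_sub h3.le]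
    · congr 1
      push_cast
      ring
    · intro i hi
      have := Finset.mem_Ico.1 hi
      rw [fanoNat, if_neg (by omega), if_neg (by omega), if_neg (by omega)]
    · intro i hi
      have := Finset.mem_Ico.1 hi
      rw [fanoNat, if_neg (by omega), if_neg (by omega), if_pos (by omega)]

/-- Either `J = 1`, and the upper plateau is the single value `1 - ε`, or the plateaus are empty and
`decr Q 1 = 1 - ε` supplies the same term. -/
theorem shannonEntropy_fanoType2_one (hsys : Admissible Q 1 ε m) :
    shannonEntropy (fanoType2 Q 1 ε m) =
      ENNReal.ofReal (Real.negMulLog (1 - ε)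
        + ((K₂ Q 1 ε m : ℝ) - 1) * Real.negMulLog (W Q 1 ε (K₂ Q 1 ε m)))
      + ∑' x : {x : ℕ+ // K₂ Q 1 ε m < (x : ℕ)},
          ENNReal.ofReal (Real.negMulLog (decr Q x.1)) := by
  have hle : topSum Q 1 ≤ 1 - ε := by linarith [hsys.2]
  rcases hle.eq_or_lt with heq | hlt
  · have hK := (J_K₂_of_topSum_eq (ε := ε) le_rfl (hsys.one_le le_rfl) heq).2
    have hd : decr Q 1 = 1 - ε := by
      have := topSum_succ Q 0
      rw [topSum_zero, zero_add, zero_add, heq] at this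
      exact this.symm
    rw [shannonEntropy, ENNReal.tsum_eq_add_tsum_ite 1,
      tsum_subtype_eq_tsum_ite _ fun x : ℕ+ => ENNReal.ofReal (Real.negMulLog (decr Q x)),
      fanoType2_of_topSum_eq le_rfl (hsys.one_le le_rfl) heq, PNat.one_coe, hd, hK]
    congr 1
    · simp
    · refine tsum_congr fun x => ?_
      rw [fanoType2_of_topSum_eq le_rfl (hsys.one_le le_rfl) heq]
      by_cases hx : x = 1
      · simp [hx]
      · have hx' : 1 < (x : ℕ) := by
          have h0 := x.pos
          have : (x : ℕ) ≠ 1 := fun h => hx (PNat.coe_eq_one_iff.1 h)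
          omega
        simp [hx, hx']
  · have h := hsys.plateaus le_rfl hlt
    have hJ : J Q 1 ε = 1 := le_antisymm h.J_le h.one_le_J
    have hV : V Q 1 ε 1 = 1 - ε := by
      simp [V, topSum_zero]
    have hval := tsum_fanoType2 le_rfl hsys Real.negMulLog fun t => Real.negMulLog_nonneg
    rw [shannonEntropy, hval, hJ, hV,
      tsum_subtype_eq_tsum_ite _ fun x : ℕ+ => ENNReal.ofReal (Real.negMulLog (decr Q x)),
      tsum_subtype_eq_tsum_ite _ fun x : ℕ+ => ENNReal.ofReal (Real.negMulLog (decr Q x))]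
    simp

end Value

end FanoRenyi
-- Passage to the suprema and assembly of the explicit values.
theorem corollary2 (𝒴 : Type v) [Fintype 𝒴] [MeasurableSpace 𝒴] [DiscreteMeasurableSpace 𝒴]
    (Q : PMF ℕ+) (L : ℕ) (hL : 1 ≤ L) (ε : ℝ) (m : ℕ) (hm : m = Fintype.card 𝒴)
    (hsys : Admissible Q L ε m) :
    -- the Fano-distribution of type 2 is a probability distribution
    ((∀ x, 0 ≤ fanoType2 Q L ε m x) ∧ HasSum (fanoType2 Q L ε m) 1) ∧
    -- the upper bounds
    (∀ α : ℝ, 0 < α →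
      supArimoto.{u, v} α Q L ε 𝒴 ≤ renyiEntropy α (fanoType2 Q L ε m) ∧
      supHayashi.{u, v} α Q L ε 𝒴 ≤ renyiEntropy α (fanoType2 Q L ε m)) ∧
    -- the explicit value for `α ≠ 1`
    (∀ α : ℝ, 0 < α → α ≠ 1 →
      renyiEntropy α (fanoType2 Q L ε m) =
        ((1 / (1 - α) : ℝ) : EReal) * ENNReal.log
          (ENNReal.ofReal (((L : ℝ) - (J Q L ε : ℝ) + 1) * V Q L ε (J Q L ε) ^ α
              + ((K₂ Q L ε m : ℝ) - (L : ℝ)) * W Q L ε (K₂ Q L ε m) ^ α)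
            + ∑' x : {x : ℕ+ // (x : ℕ) < J Q L ε ∨ K₂ Q L ε m < (x : ℕ)},
                ENNReal.ofReal (decr Q x.1 ^ α))) ∧
    -- the explicit value for `α = 1`
    (renyiEntropy 1 (fanoType2 Q L ε m) =
      ((ENNReal.ofReal (((L : ℝ) - (J Q L ε : ℝ) + 1) * Real.negMulLog (V Q L ε (J Q L ε))
          + ((K₂ Q L ε m : ℝ) - (L : ℝ)) * Real.negMulLog (W Q L ε (K₂ Q L ε m)))
        + ∑' x : {x : ℕ+ // (x : ℕ) < J Q L ε ∨ K₂ Q L ε m < (x : ℕ)},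
            ENNReal.ofReal (Real.negMulLog (decr Q x.1)) : ℝ≥0∞) : EReal)) ∧
    -- the case `α = 1`, `L = 1`
    (L = 1 →
      supShannon.{u, v} Q 1 ε 𝒴 ≤
        ENNReal.ofReal (Real.negMulLog (1 - ε)
          + ((K₂ Q 1 ε m : ℝ) - 1) * Real.negMulLog (W Q 1 ε (K₂ Q 1 ε m)))
        + ∑' x : {x : ℕ+ // K₂ Q 1 ε m < (x : ℕ)},
            ENNReal.ofReal (Real.negMulLog (decr Q x.1))) := by
  subst hm
  refine ⟨⟨fanoType2_nonneg hL hsys, hasSum_fanoType2 hL hsys⟩, fun α hα => ⟨?_, ?_⟩,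
    fun α hα hα1 => ?_, ?_, ?_⟩
  · refine sSup_le ?_
    rintro _ ⟨Ω, _, μ, _, X, Y, h, rfl⟩
    exact h.arimoto_le hL hsys hα
  · refine sSup_le ?_
    rintro _ ⟨Ω, _, μ, _, X, Y, h, rfl⟩
    exact h.hayashi_le hL hsys hα
  · rw [renyiEntropy, if_neg hα1, tsum_ofReal_rpow hα (fanoType2_nonneg hL hsys),
      tsum_fanoType2 hL hsys (fun t => t ^ α) fun t ht _ => Real.rpow_nonneg ht α]
  · rw [renyiEntropy, if_pos rfl, shannonEntropy,
      tsum_fanoType2 hL hsys Real.negMulLog fun t => Real.negMulLog_nonneg]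
  · rintro rfl
    rw [← shannonEntropy_fanoType2_one hsys]
    refine sSup_le ?_
    rintro _ ⟨Ω, _, μ, _, X, Y, h, rfl⟩
    exact h.condShannon_le hL hsys
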